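/- **Setting.** All vector spaces are real; all locally compact groups are Hausdorff; algebras need not be unital. A *cone* in a vector space $V$ is a subset $V_+\ni 0$ with $V_++V_+\subseteq V_+$ and $\lambda V_+\subseteq V_+$ for $\lambda\ge 0$ (not necessarily proper); a *pre-ordered* Banach space is a Banach space with a cone, and for a pre-ordered Banach algebra also $A_+A_+\subseteq A_+$. $B(X)$ is the algebra of bounded operators on $X$, with cone $B(X)_+=\{T: TX_+\subseteq X_+\}$ if $X$ is pre-ordered. A representation of an algebra $B$ on $X$ is an algebra homomorphism $T:B\to B(X)$; it is *non-degenerate* if the span of $\{T(b)x\}$ is dense in $X$, and *positive* if $T(B_+)\subseteq B(X)_+$. Let $A$ be a pre-ordered Banach algebra with closed cone, $G$ a locally compact group with left Haar measure $dr$, and $\alpha$ a strongly continuous action of $G$ on $A$ by bounded algebra automorphisms with $\alpha_s(A_+)\subseteq A_+$ for all $s\in G$. (Then $(A,G,\alpha)$ is a pre-ordered Banach algebra dynamical system.) A *continuous covariant representation* of $(A,G,\alpha)$ on a Banach space $X$ is a pair $(\pi,U)$ consisting of a bounded representation $\pi$ of $A$ on $X$ and a strongly continuous homomorphism $U$ from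 $G$ into the invertible operators in $B(X)$ with $\pi(\alpha_s(a))=U_s\pi(a)U_s^{-1}$. It is *non-degenerate* if $\pi$ is, and, if $X$ is pre-ordered, *positive* if $\pi$ is positive and $U_sX_+\subseteq X_+$ for all $s\in G$. Its integrated form on $C_c(G,A)$ is $(\pi\rtimes U)(f)x=\int_G\pi(f(r))U_rx\,dr$; it is a representation of the algebra $C_c(G,A)$ with the twisted convolution $(f*g)(s)=\int_G f(r)\alpha_r(g(r^{-1}s))\,dr$. Let $\mathcal R$ be a non-empty *uniformly bounded* class of continuous covariant representations of $(A,G,\alpha)$ on Banach spaces: there are $C\ge 0$ and $\nu:G\to[0,\infty)$, bounded on compact sets, with $\|\pi\|\le C$ and $\|U_r\|\le\nu(r)$ for all $(\pi,U)\in\mathcal R$ and $r\in G$. Put $\sigma^{\mathcal R}(f)=\sup_{(\pi,U)\in\mathcal R}\|(\pi\rtimes U)(f)\|$. The *crossed product* $(A\rtimes_\alpha G)^{\mathcal R}$ is the Banach algebra obtained by completing $C_c(G,A)/\ker\sigma^{\mathcal R}$ in the norm induced by $\sigma^{\mathcal R}$; with $q^{\mathcal R}$ the canonical map of $C_c(G,A)$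 into it, its cone is the closure of $q^{\mathcal R}(C_c(G,A_+))$. A continuous covariant representation $(\pi,U)$ is *$\mathcal R$-continuous* if $\pi\rtimes U$ is bounded with respect to $\sigma^{\mathcal R}$; then $(\pi\rtimes U)^{\mathcal R}$ denotes the induced bounded map on $(A\rtimes_\alpha G)^{\mathcal R}$. For a normed algebra $B$, let $\mathcal M_l(B)=\{L\in B(B): L(ab)=(La)b \text{ for all } a,b\}$, with cone $\mathcal M_l(B)\cap B(B)_+$ if $B$ is pre-ordered, and let $\lambda:B\to\mathcal M_l(B)$, $\lambda(a)b=ab$. Let $i_A^{\mathcal R}(a),i_G^{\mathcal R}(r)\in\mathcal M_l((A\rtimes_\alpha G)^{\mathcal R})$ be the operators induced by $(i_A(a)f)(s)=af(s)$ and $(i_G(r)f)(s)=\alpha_r(f(r^{-1}s))$ on $C_c(G,A)$. **Theorem.** Suppose that $A$ has a positive bounded approximate left identity, i.e. there are a net $(u_i)$ in $A_+$ and $M\ge 0$ with $\|u_i\|\le M$ for all $i$ and $u_ia\to a$ for all $a\in A$, and that all members of $\mathcal R$ are non-degenerate. Then the map $(\pi,U)\mapsto(\pi\rtimes U)^{\mathcal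 R}$ is a bijection from the positive non-degenerate $\mathcal R$-continuous covariant representations of $(A,G,\alpha)$ on pre-ordered Banach spaces with closed cones onto the positive non-degenerate bounded representations of $(A\rtimes_\alpha G)^{\mathcal R}$ on such spaces; for every such space $X$ it is a bijection between the representations of the two kinds on $X$. More precisely: (0) If $T$ is a positive non-degenerate bounded representation of $(A\rtimes_\alpha G)^{\mathcal R}$ on a pre-ordered Banach space $X$ with closed cone, then there is a unique representation $\overline T$ of $\mathcal M_l((A\rtimes_\alpha G)^{\mathcal R})$ on $X$ with $\overline T\circ\lambda=T$. It is positive, non-degenerate and bounded, and $\overline T(L)x=\lim_j T(Lv_j)x$ for all $L\in \mathcal M_l((A\rtimes_\alpha G)^{\mathcal R})$, all $x\in X$ and every bounded approximate left identity $(v_j)$ of $(A\rtimes_\alpha G)^{\mathcal R}$. (1) If $(\pi,U)$ is a positive non-degenerate $\mathcal R$-continuous covariant representation of $(A,G,\alpha)$ on a pre-ordered Banach space $X$ with closed cone, then $T:=(\pi\rtimes U)^{\mathcal R}$ is a positive non-degenerate bounded representation of $(A\rtimes_\alpha G)^{\mathcal R}$ on $X$, and $(\overline T\circ i_A^{\mathcal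 R},\overline T\circ i_G^{\mathcal R})=(\pi,U)$. (2) If $T$ is a positive non-degenerate bounded representation of $(A\rtimes_\alpha G)^{\mathcal R}$ on a pre-ordered Banach space $X$ with closed cone, then $(\overline T\circ i_A^{\mathcal R},\overline T\circ i_G^{\mathcal R})$ is a positive non-degenerate $\mathcal R$-continuous covariant representation of $(A,G,\alpha)$ on $X$, and $(\overline T\circ i_A^{\mathcal R}\rtimes\overline T\circ i_G^{\mathcal R})^{\mathcal R}=T$. -/

import Mathlib

open MeasureTheory Filter Topology
open scoped CompactlySupported

noncomputable section

/-! ## Representations of normed algebras, cones, approximate identities -/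

section Basic

variable {B X : Type*} [NonUnitalNormedRing B] [NormedSpace ℝ B]
  [NormedAddCommGroup X] [NormedSpace ℝ X]

/-- A map `T : B → B(X)` is non-degenerate if the linear span of
`{T b x | b ∈ B, x ∈ X}` is dense in `X`. -/
def IsNondegenerateRep {S : Type*} (T : S → X →L[ℝ] X) : Prop :=
  Dense (Submodule.span ℝ {y : X | ∃ b x, y = T b x} : Set X)

/-- A map `T : B → B(X)` on a normed space is bounded if `‖T b‖ ≤ C ‖b‖` for some constant `C`. -/
def IsBoundedRep {S : Type*} [Norm S] (T : S → X →L[ℝ] X) : Prop :=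
  ∃ C : ℝ, ∀ b, ‖T b‖ ≤ C * ‖b‖

/-- The natural operator cone of `B(X)` for a space `X` with cone `K`: the operators `T` with
`T K ⊆ K`. -/
def operatorCone (K : PointedCone ℝ X) : PointedCone ℝ (X →L[ℝ] X) where
  carrier := {T | ∀ x ∈ K, T x ∈ K}
  add_mem' hS hT x hx := K.add_mem (hS x hx) (hT x hx)
  zero_mem' _ _ := K.zero_mem
  smul_mem' c _ hT x hx := Submodule.smul_mem K c (hT x hx)

/-- A representation `T` of an algebra with cone `C` on a space with cone `K` is positive if
it maps `C` into the operator cone. -/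
def IsPositiveRep {S : Type*} [AddCommMonoid S] [Module ℝ S] (C : PointedCone ℝ S)
    (K : PointedCone ℝ X) (T : S → X →L[ℝ] X) : Prop :=
  ∀ b ∈ C, T b ∈ operatorCone K

/-- A net `u` is a bounded approximate left identity of `B`. -/
structure IsBoundedApproxLeftIdentity {I : Type*} [Preorder I] (u : I → B) : Prop where
  bounded : ∃ M : ℝ, ∀ i, ‖u i‖ ≤ M
  tendsto_mul : ∀ b : B, Tendsto (fun i => u i * b) atTop (𝓝 b)

variable (B) in
/-- The left centralizer algebra of `B`: the bounded operators `L` on `B` such that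
`L (a b) = (L a) b`, as a unital subalgebra of `B(B)`. -/
def leftCentralizerAlgebra [IsScalarTower ℝ B B] : Subalgebra ℝ (B →L[ℝ] B) where
  carrier := {L | ∀ a b : B, L (a * b) = L a * b}
  mul_mem' := by
    intro L M hL hM a b
    change L (M (a * b)) = L (M a) * b
    rw [hM a b, hL]
  add_mem' := by
    intro L M hL hM a b
    simp only [add_apply, hL a b, hM a b, add_mul]
  algebraMap_mem' := by
    intro r a b
    simp [Algebra.algebraMap_eq_smul_one, smul_mul_assoc]

/-- The left regular representation `lam : B → M_l(B)`, `lam a b = a b`. -/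
def leftRegular [IsScalarTower ℝ B B] [SMulCommClass ℝ B B] (a : B) : leftCentralizerAlgebra B :=
  ⟨ContinuousLinearMap.mul ℝ B a, fun b c => by simp [mul_assoc]⟩

/-- The cone of the left centralizer algebra: the left centralizers that are positive operators
on `B`. -/
def leftCentralizerCone [IsScalarTower ℝ B B] (C : PointedCone ℝ B) : PointedCone ℝ (leftCentralizerAlgebra B) where
  carrier := {L | (L : B →L[ℝ] B) ∈ operatorCone C}
  add_mem' hS hT := (operatorCone C).add_mem hS hT
  zero_mem' := (operatorCone C).zero_mem
  smul_mem' c _ hT := Submodule.smul_mem (operatorCone C) c hT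

/-- `Tbar` is the canonical extension of the representation `T` of `B` on `X` to the left
centralizer algebra: it is the unique representation of `M_l(B)` on `X` with `Tbar ∘ lam = T`,
it is non-degenerate and bounded, and it is given by `Tbar L = SOT-lim T (L (u i))` for every
bounded approximate left identity of `B`. (The latter is expressed with a filter `l` on `B`, which
covers all nets `u` in `B`, indexed by a directed set in any universe, by taking `l` to be the
filter of sets that eventually contain `u i`.) -/
structure IsCentralizerExtension [IsScalarTower ℝ B B] [SMulCommClass ℝ B B]
    (T : B →ₙₐ[ℝ] (X →L[ℝ] X)) (Tbar : leftCentralizerAlgebra B →ₙₐ[ℝ] (X →L[ℝ] X)) : Prop where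
  apply_leftRegular : ∀ b, Tbar (leftRegular b) = T b
  unique : ∀ S : leftCentralizerAlgebra B →ₙₐ[ℝ] (X →L[ℝ] X),
    (∀ b, S (leftRegular b) = T b) → S = Tbar
  nondegenerate : IsNondegenerateRep Tbar
  bounded : IsBoundedRep Tbar
  tendsto : ∀ l : Filter B, (∃ M : ℝ, ∀ᶠ e in l, ‖e‖ ≤ M) →
    (∀ b, Tendsto (fun e => e * b) l (𝓝 b)) → ∀ (L : leftCentralizerAlgebra B) (x : X),
    Tendsto (fun e => T (L.1 e) x) l (𝓝 (Tbar L x))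

end Basic

/-! ## Banach algebra dynamical systems and covariant representations -/

section Systems

universe u v w

variable {A : Type u} {G : Type v} [NonUnitalNormedRing A] [NormedSpace ℝ A] [Group G] [TopologicalSpace G]

variable (A G) in
/-- A Banach algebra dynamical system: a strongly continuous action `α` of `G` on `A` by bounded
algebra automorphisms. (The operators `α s` are invertible with inverse `α s⁻¹`, because `α` is
a homomorphism of monoids defined on a group.) -/
structure BanachDynamicalSystem where
  α : G →* (A →L[ℝ] A)
  map_mul : ∀ s a b, α s (a * b) = α s a * α s b
  continuous_apply : ∀ a, Continuous fun s => α s a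

variable (A G) in
/-- A pre-ordered Banach algebra dynamical system: `A` carries a closed cone that is closed under
multiplication, and `α` takes values in the positive automorphisms. (Positivity of `α s⁻¹`
is included since `s` is arbitrary.) -/
structure PreorderedBanachDynamicalSystem extends BanachDynamicalSystem A G where
  cone : PointedCone ℝ A
  isClosed_cone : IsClosed (cone : Set A)
  mul_mem_cone : ∀ a ∈ cone, ∀ b ∈ cone, a * b ∈ cone
  α_mem_cone : ∀ s, ∀ a ∈ cone, α s a ∈ cone

/-- A continuous covariant representation of a Banach algebra dynamical system on `X`: a bounded
representation `π` of `A` and a strongly continuous representation `U` of `G` by invertible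
operators (`U s` has inverse `U s⁻¹`) with `π (α s a) = U s π(a) (U s)⁻¹`. -/
structure ContinuousCovariantRep (D : BanachDynamicalSystem A G) (X : Type*)
    [NormedAddCommGroup X] [NormedSpace ℝ X] where
  π : A →ₙₐ[ℝ] (X →L[ℝ] X)
  U : G →* (X →L[ℝ] X)
  bounded : IsBoundedRep π
  continuous_apply : ∀ x, Continuous fun s => U s x
  covariant : ∀ s a, π (D.α s a) = U s * π a * U s⁻¹

/-- A covariant representation is non-degenerate if `π` is. -/
def ContinuousCovariantRep.Nondegenerate {D : BanachDynamicalSystem A G} {X : Type*}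
    [NormedAddCommGroup X] [NormedSpace ℝ X] (P : ContinuousCovariantRep D X) : Prop :=
  IsNondegenerateRep P.π

/-- A covariant representation `(π, U)` on a space with cone `K` is positive if `π` is positive
and all operators `U s` (hence also their inverses `U s⁻¹`) are positive. -/
def ContinuousCovariantRep.Positive {D : PreorderedBanachDynamicalSystem A G} {X : Type*}
    [NormedAddCommGroup X] [NormedSpace ℝ X]
    (P : ContinuousCovariantRep D.toBanachDynamicalSystem X) (K : PointedCone ℝ X) : Prop :=
  IsPositiveRep D.cone K P.π ∧ ∀ s, P.U s ∈ operatorCone K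

/-- A continuous covariant representation together with the Banach space on which it acts. -/
structure BanachCovariantRep (D : BanachDynamicalSystem A G) where
  X : Type w
  [normedAddCommGroup : NormedAddCommGroup X]
  [normedSpace : NormedSpace ℝ X]
  [completeSpace : CompleteSpace X]
  rep : ContinuousCovariantRep D X

attribute [instance] BanachCovariantRep.normedAddCommGroup BanachCovariantRep.normedSpace
  BanachCovariantRep.completeSpace

/-- A (non-empty) uniformly bounded class of continuous covariant representations of `D` on Banach
spaces: there are `C ≥ 0` and `ν : G → [0, ∞)`, bounded on compact sets, such that
`‖π‖ ≤ C` and `‖U r‖ ≤ ν r` for all members `(π, U)` and all `r`. -/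
structure UniformlyBoundedClass (D : BanachDynamicalSystem A G) where
  reps : Set (BanachCovariantRep.{u, v, w} D)
  nonempty : reps.Nonempty
  uniformly_bounded : ∃ (C : ℝ) (ν : G → ℝ), 0 ≤ C ∧ (∀ r, 0 ≤ ν r) ∧
    (∀ K : Set G, IsCompact K → BddAbove (ν '' K)) ∧
    ∀ P ∈ reps, (∀ a, ‖P.rep.π a‖ ≤ C * ‖a‖) ∧ ∀ r, ‖P.rep.U r‖ ≤ ν r

end Systems

/-! ## Integrated forms and twisted convolution -/

section Integrated

set_option linter.unusedSectionVars false

variable {A G X : Type*} [NonUnitalNormedRing A] [NormedSpace ℝ A]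
  [Group G] [TopologicalSpace G]
  [NormedAddCommGroup X] [NormedSpace ℝ X]

theorem exists_bound_of_stronglyContinuous [CompleteSpace X] {U : G → X →L[ℝ] X}
    (hU : ∀ x, Continuous fun s => U s x) {K : Set G} (hK : IsCompact K) :
    ∃ M, ∀ s ∈ K, ‖U s‖ ≤ M := by
  obtain ⟨M, hM⟩ := banach_steinhaus (g := fun s : K => U s) (fun x => by
    obtain ⟨M, hM⟩ := hK.exists_bound_of_continuousOn (hU x).continuousOn
    exact ⟨M, fun s => hM s s.2⟩)
  exact ⟨M, fun s hs => hM ⟨s, hs⟩⟩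

theorem continuous_uncurry_of_stronglyContinuous [LocallyCompactSpace G] [CompleteSpace X]
    {U : G → X →L[ℝ] X} (hU : ∀ x, Continuous fun s => U s x) :
    Continuous fun p : G × X => U p.1 p.2 := by
  rw [continuous_iff_continuousAt]
  rintro ⟨s, x⟩
  obtain ⟨K, hK, hs⟩ := exists_compact_mem_nhds s
  obtain ⟨M, hM⟩ := exists_bound_of_stronglyContinuous hU hK
  have h1 : Tendsto (fun p : G × X => U p.1 x) (𝓝 (s, x)) (𝓝 (U s x)) :=
    ((hU x).comp continuous_fst).continuousAt
  have h2 : Tendsto (fun p : G × X => U p.1 (p.2 - x)) (𝓝 (s, x)) (𝓝 0) := by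
    have h3 : Tendsto (fun p : G × X => M * ‖p.2 - x‖) (𝓝 (s, x)) (𝓝 0) := by
      have : Continuous fun p : G × X => M * ‖p.2 - x‖ := by fun_prop
      simpa using this.tendsto (s, x)
    refine squeeze_zero_norm' ?_ h3
    have h4 : ∀ᶠ p : G × X in 𝓝 (s, x), p.1 ∈ K := continuous_fst.continuousAt hs
    filter_upwards [h4] with p hp
    exact (U p.1).le_of_opNorm_le (hM _ hp) _
  have := h1.add h2
  simpa [ContinuousAt] using this

namespace ContinuousCovariantRep

variable {D : BanachDynamicalSystem A G} (P : ContinuousCovariantRep D X)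

/-- `π` as a bounded linear map. -/
def πL : A →L[ℝ] (X →L[ℝ] X) :=
  LinearMap.mkContinuousOfExistsBound
    { toFun := P.π, map_add' := map_add P.π, map_smul' := map_smul P.π } P.bounded

@[simp] theorem πL_apply (a : A) : P.πL a = P.π a := rfl

theorem U_mul_apply (s t : G) (x : X) : P.U (s * t) x = P.U s (P.U t x) := by
  rw [map_mul]; rfl

theorem π_mul_apply (a b : A) (x : X) : P.π (a * b) x = P.π a (P.π b x) := by
  rw [map_mul]; rfl

theorem π_α_U (s : G) (a : A) (x : X) : P.π (D.α s a) (P.U s x) = P.U s (P.π a x) := by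
  rw [P.covariant]
  change P.U s (P.π a (P.U s⁻¹ (P.U s x))) = _
  rw [← P.U_mul_apply, inv_mul_cancel, map_one]
  rfl

variable [IsTopologicalGroup G] [LocallyCompactSpace G] [T2Space G] [CompleteSpace X]

theorem continuous_integrand (f : C_c(G, A)) {k : G → X} (hk : Continuous k) :
    Continuous fun p : G × G => P.π (f p.2) (P.U p.2 (k (p.2⁻¹ * p.1))) := by
  have h1 : Continuous fun p : G × G => P.U p.2 (k (p.2⁻¹ * p.1)) :=
    (continuous_uncurry_of_stronglyContinuous P.continuous_apply).comp
      (continuous_snd.prodMk (hk.comp (by fun_prop)))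
  have h2 : Continuous fun p : G × G => P.πL (f p.2) :=
    P.πL.continuous.comp (f.continuous.comp continuous_snd)
  exact h2.clm_apply h1

variable [MeasurableSpace G] [BorelSpace G] (μ : Measure G) [μ.IsHaarMeasure]

theorem integrable_integrand (f : C_c(G, A)) {k : G → X} (hk : Continuous k) (s : G) :
    Integrable (fun r => P.π (f r) (P.U r (k (r⁻¹ * s)))) μ := by
  refine Continuous.integrable_of_hasCompactSupport ?_ ?_
  · exact (P.continuous_integrand f hk).comp (continuous_const.prodMk continuous_id)
  · refine f.hasCompactSupport.mono ?_
    intro r hr h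
    exact hr (by simp only [h, map_zero]; rfl)

/-- The auxiliary function `s ↦ ∫ π(f r) U_r k(r⁻¹ s) dr`. -/
def act (f : C_c(G, A)) (k : G → X) (s : G) : X :=
  ∫ r, P.π (f r) (P.U r (k (r⁻¹ * s))) ∂μ

theorem continuous_act (f : C_c(G, A)) {k : G → X} (hk : Continuous k) :
    Continuous (P.act μ f k) := by
  rw [← continuousOn_univ]
  refine continuousOn_integral_of_compact_support (k := tsupport f) f.hasCompactSupport
    (P.continuous_integrand f hk).continuousOn ?_
  intro s r _ hr
  rw [image_eq_zero_of_notMem_tsupport hr, map_zero]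
  rfl

theorem act_add_left (f g : C_c(G, A)) {k : G → X} (hk : Continuous k) (s : G) :
    P.act μ (f + g) k s = P.act μ f k s + P.act μ g k s := by
  unfold act
  rw [← integral_add (P.integrable_integrand μ f hk s) (P.integrable_integrand μ g hk s)]
  simp

theorem act_smul_left (c : ℝ) (f : C_c(G, A)) (k : G → X) (s : G) :
    P.act μ (c • f) k s = c • P.act μ f k s := by
  unfold act
  rw [← integral_smul]
  simp

theorem act_add_right (f : C_c(G, A)) {k l : G → X} (hk : Continuous k) (hl : Continuous l)
    (s : G) : P.act μ f (fun t => k t + l t) s = P.act μ f k s + P.act μ f l s := by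
  unfold act
  rw [← integral_add (P.integrable_integrand μ f hk s) (P.integrable_integrand μ f hl s)]
  simp

theorem act_smul_right (c : ℝ) (f : C_c(G, A)) (k : G → X) (s : G) :
    P.act μ f (fun t => c • k t) s = c • P.act μ f k s := by
  unfold act
  rw [← integral_smul]
  simp

/-- The integrated form of a continuous covariant representation:
`(π ⋊ U)(f) x = ∫ π(f r) U_r x dr`. -/
def integratedForm : C_c(G, A) →ₗ[ℝ] (X →L[ℝ] X) where
  toFun f := LinearMap.mkContinuousOfExistsBound
    { toFun := fun x => ∫ r, P.π (f r) (P.U r x) ∂μ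
      map_add' := fun x y => P.act_add_right μ f (k := fun _ => x) (l := fun _ => y)
        continuous_const continuous_const 1
      map_smul' := fun c x => P.act_smul_right μ c f (fun _ => x) 1 } (by
        obtain ⟨M, hM⟩ := exists_bound_of_stronglyContinuous P.continuous_apply f.hasCompactSupport
        refine ⟨∫ r, ‖P.πL (f r)‖ * M ∂μ, fun x => ?_⟩
        rw [← integral_mul_const]
        refine norm_integral_le_of_norm_le ?_ (Eventually.of_forall fun r => ?_)
        · refine Continuous.integrable_of_hasCompactSupport ?_ ?_
          · have : Continuous fun r => P.πL (f r) := P.πL.continuous.comp f.continuous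
            fun_prop
          · refine f.hasCompactSupport.mono ?_
            intro r hr h
            exact hr (by simp [h])
        · by_cases hr : r ∈ tsupport f
          · rw [mul_assoc]
            exact (P.πL (f r)).le_of_opNorm_le_of_le le_rfl
              ((P.U r).le_of_opNorm_le (hM r hr) x)
          · simp [image_eq_zero_of_notMem_tsupport hr])
  map_add' f g := by
    ext x
    exact P.act_add_left μ f g (k := fun _ => x) continuous_const 1
  map_smul' c f := by
    ext x
    exact P.act_smul_left μ c f (fun _ => x) 1

theorem integratedForm_apply (f : C_c(G, A)) (x : X) :
    P.integratedForm μ f x = ∫ r, P.π (f r) (P.U r x) ∂μ := rfl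

theorem integratedForm_eq_act (f : C_c(G, A)) (x : X) (s : G) :
    P.integratedForm μ f x = P.act μ f (fun _ => x) s := rfl

theorem norm_integratedForm_le (f : C_c(G, A)) {C M : ℝ} (hC : 0 ≤ C)
    (hπ : ∀ a, ‖P.π a‖ ≤ C * ‖a‖) (hM : 0 ≤ M) (hU : ∀ r ∈ tsupport f, ‖P.U r‖ ≤ M) :
    ‖P.integratedForm μ f‖ ≤ C * M * ∫ r, ‖f r‖ ∂μ := by
  refine ContinuousLinearMap.opNorm_le_bound _
    (mul_nonneg (mul_nonneg hC hM) (integral_nonneg fun r => norm_nonneg _)) fun x => ?_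
  rw [integratedForm_apply]
  have : C * M * (∫ r, ‖f r‖ ∂μ) * ‖x‖ = ∫ r, C * M * ‖f r‖ * ‖x‖ ∂μ := by
    rw [integral_mul_const, integral_const_mul]
  rw [this]
  refine norm_integral_le_of_norm_le ?_ (Eventually.of_forall fun r => ?_)
  · refine Continuous.integrable_of_hasCompactSupport ?_ ?_
    · have := f.continuous
      fun_prop
    · refine f.hasCompactSupport.mono ?_
      intro r hr h
      exact hr (by simp [h])
  · by_cases hr : r ∈ tsupport f
    · have h1 := (P.U r).le_of_opNorm_le (hU r hr) x
      have h2 := (P.π (f r)).le_of_opNorm_le_of_le (hπ (f r)) h1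
      calc _ ≤ C * ‖f r‖ * (M * ‖x‖) := h2
        _ = _ := by ring
    · simp [image_eq_zero_of_notMem_tsupport hr]

end ContinuousCovariantRep

namespace BanachDynamicalSystem

variable (D : BanachDynamicalSystem A G)

/-- Left multiplication and `α` form a continuous covariant representation of the system on `A`
itself. -/
def leftRep [IsScalarTower ℝ A A] [SMulCommClass ℝ A A] : ContinuousCovariantRep D A where
  π :=
    { toFun := fun a => ContinuousLinearMap.mul ℝ A a
      map_smul' := by intro c a; simp
      map_zero' := by simp
      map_add' := by intro a b; simp
      map_mul' := by intro a b; ext c; simp [mul_assoc] }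
  U := D.α
  bounded := ⟨1, fun a => by
    rw [one_mul]
    exact ContinuousLinearMap.opNorm_mul_apply_le ℝ A a⟩
  continuous_apply := D.continuous_apply
  covariant s a := by
    ext b
    change D.α s a * b = D.α s (a * D.α s⁻¹ b)
    rw [D.map_mul]
    congr 1
    change b = (D.α s * D.α s⁻¹) b
    rw [← _root_.map_mul, mul_inv_cancel, map_one]
    rfl

variable [IsScalarTower ℝ A A] [SMulCommClass ℝ A A] [CompleteSpace A] [CompleteSpace X]
  [IsTopologicalGroup G] [LocallyCompactSpace G] [T2Space G]
  [MeasurableSpace G] [BorelSpace G] (μ : Measure G) [μ.IsHaarMeasure]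

open scoped Pointwise in
/-- The twisted convolution `(f * g)(s) = ∫ f(r) α_r(g(r⁻¹ s)) dr` on `C_c(G, A)`. -/
def twistedConv (f g : C_c(G, A)) : C_c(G, A) where
  toFun s := ∫ r, f r * D.α r (g (r⁻¹ * s)) ∂μ
  continuous_toFun := D.leftRep.continuous_act μ f g.continuous
  hasCompactSupport' := by
    refine HasCompactSupport.intro (K := tsupport f * tsupport g)
      (f.hasCompactSupport.isCompact.mul g.hasCompactSupport) fun s hs => ?_
    refine integral_eq_zero_of_ae (Eventually.of_forall fun r => ?_)
    by_cases hr : r ∈ tsupport f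
    · have : r⁻¹ * s ∉ tsupport g := fun h => hs ⟨r, hr, r⁻¹ * s, h, by simp⟩
      simp [image_eq_zero_of_notMem_tsupport this]
    · simp [image_eq_zero_of_notMem_tsupport hr]

theorem twistedConv_apply (f g : C_c(G, A)) (s : G) :
    D.twistedConv μ f g s = ∫ r, f r * D.α r (g (r⁻¹ * s)) ∂μ := rfl

theorem twistedConv_eq_act (f g : C_c(G, A)) (s : G) :
    D.twistedConv μ f g s = D.leftRep.act μ f g s := rfl

open scoped Pointwise in
theorem act_twistedConv {D : BanachDynamicalSystem A G} (P : ContinuousCovariantRep D X)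
    (f g : C_c(G, A)) {k : G → X} (hk : Continuous k) (s : G) :
    P.act μ (D.twistedConv μ f g) k s = P.act μ f (P.act μ g k) s := by
  let F : G → G → X := fun t r =>
    P.π (f r) (P.π (D.α r (g (r⁻¹ * t))) (P.U t (k (t⁻¹ * s))))
  have hF : Continuous F.uncurry := by
    have h1 : Continuous fun p : G × G => P.U p.1 (k (p.1⁻¹ * s)) :=
      (continuous_uncurry_of_stronglyContinuous P.continuous_apply).comp
        (continuous_fst.prodMk (hk.comp (by fun_prop)))
    have h2 : Continuous fun p : G × G => D.α p.2 (g (p.2⁻¹ * p.1)) :=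
      (continuous_uncurry_of_stronglyContinuous D.continuous_apply).comp
        (continuous_snd.prodMk (g.continuous.comp (by fun_prop)))
    have h3 : Continuous fun p : G × G => P.πL (f p.2) :=
      P.πL.continuous.comp (f.continuous.comp continuous_snd)
    exact h3.clm_apply ((P.πL.continuous.comp h2).clm_apply h1)
  have hF' : HasCompactSupport F.uncurry := by
    refine HasCompactSupport.intro (K := (tsupport f * tsupport g) ×ˢ tsupport f)
      ((f.hasCompactSupport.isCompact.mul g.hasCompactSupport).prod f.hasCompactSupport) ?_
    rintro ⟨t, r⟩ h
    change P.π (f r) (P.π (D.α r (g (r⁻¹ * t))) (P.U t (k (t⁻¹ * s)))) = 0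
    by_cases hr : r ∈ tsupport f
    · have : r⁻¹ * t ∉ tsupport g := fun h' => h ⟨⟨r, hr, r⁻¹ * t, h', by simp⟩, hr⟩
      simp [image_eq_zero_of_notMem_tsupport this]
    · simp [image_eq_zero_of_notMem_tsupport hr]
  have e1 : ∀ t, P.π (D.twistedConv μ f g t) (P.U t (k (t⁻¹ * s))) = ∫ r, F t r ∂μ := by
    intro t
    have := (P.πL.flip (P.U t (k (t⁻¹ * s)))).integral_comp_comm
      (D.leftRep.integrable_integrand μ f g.continuous t)
    rw [twistedConv_eq_act]
    refine Eq.trans this.symm ?_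
    congr 1
    ext r
    change P.π (f r * D.α r (g (r⁻¹ * t))) _ = _
    rw [P.π_mul_apply]
  have e2 : ∀ r, ∫ t, F t r ∂μ = P.π (f r) (P.U r (P.act μ g k (r⁻¹ * s))) := by
    intro r
    rw [← integral_mul_left_eq_self _ r]
    have := (P.π (f r) * P.U r).integral_comp_comm
      (P.integrable_integrand μ g hk (r⁻¹ * s))
    refine Eq.trans ?_ this
    congr 1
    ext t
    change P.π (f r) (P.π (D.α r (g (r⁻¹ * (r * t)))) (P.U (r * t) (k ((r * t)⁻¹ * s)))) =
      P.π (f r) (P.U r (P.π (g t) (P.U t (k (t⁻¹ * (r⁻¹ * s))))))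
    rw [P.U_mul_apply, P.π_α_U, inv_mul_cancel_left, mul_inv_rev, mul_assoc]
  calc P.act μ (D.twistedConv μ f g) k s = ∫ t, ∫ r, F t r ∂μ ∂μ := by
        unfold ContinuousCovariantRep.act
        simp_rw [e1]
    _ = ∫ r, ∫ t, F t r ∂μ ∂μ := integral_integral_swap_of_hasCompactSupport hF hF'
    _ = _ := by
        simp_rw [e2]
        rfl

theorem integratedForm_twistedConv {D : BanachDynamicalSystem A G}
    (P : ContinuousCovariantRep D X) (f g : C_c(G, A)) :
    P.integratedForm μ (D.twistedConv μ f g) = P.integratedForm μ f * P.integratedForm μ g := by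
  ext x
  exact act_twistedConv μ P f g continuous_const 1

theorem twistedConv_assoc (f g h : C_c(G, A)) :
    D.twistedConv μ (D.twistedConv μ f g) h = D.twistedConv μ f (D.twistedConv μ g h) := by
  ext s
  exact act_twistedConv μ D.leftRep f g h.continuous s

theorem add_twistedConv (f g h : C_c(G, A)) :
    D.twistedConv μ (f + g) h = D.twistedConv μ f h + D.twistedConv μ g h := by
  ext s
  exact D.leftRep.act_add_left μ f g h.continuous s

theorem twistedConv_add (f g h : C_c(G, A)) :
    D.twistedConv μ f (g + h) = D.twistedConv μ f g + D.twistedConv μ f h := by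
  ext s
  exact D.leftRep.act_add_right μ f g.continuous h.continuous s

theorem smul_twistedConv (c : ℝ) (f g : C_c(G, A)) :
    D.twistedConv μ (c • f) g = c • D.twistedConv μ f g := by
  ext s
  exact D.leftRep.act_smul_left μ c f g s

theorem twistedConv_smul (c : ℝ) (f g : C_c(G, A)) :
    D.twistedConv μ f (c • g) = c • D.twistedConv μ f g := by
  ext s
  exact D.leftRep.act_smul_right μ c f g s

/-- The operator `i_A(a)` on `C_c(G, A)`: `(i_A(a) f)(s) = a f(s)`. -/
def iA (a : A) : C_c(G, A) →ₗ[ℝ] C_c(G, A) where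
  toFun f :=
    { toFun := fun s => a * f s
      continuous_toFun := continuous_const.mul f.continuous
      hasCompactSupport' := f.hasCompactSupport.mono fun s hs h => hs (by simp [h]) }
  map_add' f g := by ext s; exact mul_add _ _ _
  map_smul' c f := by ext s; exact mul_smul_comm _ _ _

/-- The operator `i_G(r)` on `C_c(G, A)`: `(i_G(r) f)(s) = α_r(f(r⁻¹ s))`. -/
def iG (r : G) : C_c(G, A) →ₗ[ℝ] C_c(G, A) where
  toFun f :=
    { toFun := fun s => D.α r (f (r⁻¹ * s))
      continuous_toFun := by
        have := f.continuous
        fun_prop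
      hasCompactSupport' := by
        have h := f.hasCompactSupport.comp_homeomorph (Homeomorph.mulLeft r⁻¹)
        exact h.mono fun s hs h => hs (by
          change f (r⁻¹ * s) = 0 at h
          simp [h]) }
  map_add' f g := by ext s; exact map_add (D.α r) _ _
  map_smul' c f := by ext s; exact map_smul (D.α r) _ _

theorem iA_apply (a : A) (f : C_c(G, A)) (s : G) : iA a f s = a * f s := rfl

theorem iG_apply (r : G) (f : C_c(G, A)) (s : G) : D.iG r f s = D.α r (f (r⁻¹ * s)) := rfl

theorem act_iA {D : BanachDynamicalSystem A G} (P : ContinuousCovariantRep D X) (a : A)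
    (f : C_c(G, A)) {k : G → X} (hk : Continuous k) (s : G) :
    P.act μ (iA a f) k s = P.π a (P.act μ f k s) := by
  refine Eq.trans ?_ ((P.π a).integral_comp_comm (P.integrable_integrand μ f hk s))
  unfold ContinuousCovariantRep.act
  congr 1
  ext r
  rw [iA_apply, P.π_mul_apply]

theorem act_iG {D : BanachDynamicalSystem A G} (P : ContinuousCovariantRep D X) (t : G)
    (f : C_c(G, A)) {k : G → X} (hk : Continuous k) (s : G) :
    P.act μ (D.iG t f) k s = P.U t (P.act μ f k (t⁻¹ * s)) := by
  refine Eq.trans ?_ ((P.U t).integral_comp_comm (P.integrable_integrand μ f hk (t⁻¹ * s)))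
  unfold ContinuousCovariantRep.act
  rw [← integral_mul_left_eq_self _ t]
  congr 1
  ext r
  rw [iG_apply, P.U_mul_apply, P.π_α_U, inv_mul_cancel_left, mul_inv_rev, mul_assoc]

theorem integratedForm_iA {D : BanachDynamicalSystem A G} (P : ContinuousCovariantRep D X)
    (a : A) (f : C_c(G, A)) :
    P.integratedForm μ (iA a f) = P.π a * P.integratedForm μ f := by
  ext x
  exact act_iA μ P a f continuous_const 1

theorem integratedForm_iG {D : BanachDynamicalSystem A G} (P : ContinuousCovariantRep D X)
    (t : G) (f : C_c(G, A)) :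
    P.integratedForm μ (D.iG t f) = P.U t * P.integratedForm μ f := by
  ext x
  exact act_iG μ P t f continuous_const 1

theorem iA_twistedConv (a : A) (f g : C_c(G, A)) :
    iA a (D.twistedConv μ f g) = D.twistedConv μ (iA a f) g := by
  ext s
  exact (act_iA μ D.leftRep a f g.continuous s).symm

theorem iG_twistedConv (t : G) (f g : C_c(G, A)) :
    D.iG t (D.twistedConv μ f g) = D.twistedConv μ (D.iG t f) g := by
  ext s
  exact (act_iG μ D.leftRep t f g.continuous s).symm

end BanachDynamicalSystem

end Integrated

/-! ## The crossed product -/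

section Crossed

set_option linter.unusedSectionVars false

universe u v w

variable {A : Type u} {G : Type v} [NonUnitalNormedRing A] [NormedSpace ℝ A]
  [IsScalarTower ℝ A A] [SMulCommClass ℝ A A] [CompleteSpace A]
  [Group G] [TopologicalSpace G] [IsTopologicalGroup G] [LocallyCompactSpace G] [T2Space G]
  [MeasurableSpace G] [BorelSpace G]

namespace UniformlyBoundedClass

variable {D : BanachDynamicalSystem A G} (R : UniformlyBoundedClass.{u, v, w} D)
  (μ : Measure G) [μ.IsHaarMeasure]

theorem bddAbove_norm (f : C_c(G, A)) :
    BddAbove (Set.range fun P : R.reps => ‖P.1.rep.integratedForm μ f‖) := by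
  obtain ⟨C, ν, hC, hν, hK, h⟩ := R.uniformly_bounded
  obtain ⟨M, hM⟩ := hK _ f.hasCompactSupport
  refine ⟨C * max M 0 * ∫ r, ‖f r‖ ∂μ, ?_⟩
  rintro _ ⟨P, rfl⟩
  refine P.1.rep.norm_integratedForm_le μ f hC (h P.1 P.2).1 (le_max_right _ _) fun r hr => ?_
  exact ((h P.1 P.2).2 r).trans ((hM ⟨r, hr, rfl⟩).trans (le_max_left _ _))

/-- The seminorm `σ^R(f) = sup ‖(π ⋊ U)(f)‖` on `C_c(G, A)`, with the supremum taken over all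
`(π, U)` in the class `R`. -/
def sigma : Seminorm ℝ C_c(G, A) :=
  Seminorm.of (fun f => ⨆ P : R.reps, ‖P.1.rep.integratedForm μ f‖)
    (fun f g => by
      have := R.nonempty.to_subtype
      refine ciSup_le fun P => ?_
      rw [map_add]
      exact (norm_add_le _ _).trans
        (add_le_add (le_ciSup (R.bddAbove_norm μ f) P) (le_ciSup (R.bddAbove_norm μ g) P)))
    (fun c f => by
      simp_rw [map_smul, norm_smul]
      exact (Real.mul_iSup_of_nonneg (norm_nonneg c) _).symm)

theorem sigma_apply (f : C_c(G, A)) :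
    R.sigma μ f = ⨆ P : R.reps, ‖P.1.rep.integratedForm μ f‖ := rfl

theorem norm_integratedForm_le_sigma (f : C_c(G, A)) {P : BanachCovariantRep D}
    (hP : P ∈ R.reps) : ‖P.rep.integratedForm μ f‖ ≤ R.sigma μ f :=
  le_ciSup (R.bddAbove_norm μ f) (⟨P, hP⟩ : R.reps)

theorem sigma_le {f : C_c(G, A)} {c : ℝ}
    (h : ∀ P ∈ R.reps, ‖P.rep.integratedForm μ f‖ ≤ c) : R.sigma μ f ≤ c := by
  have := R.nonempty.to_subtype
  exact ciSup_le fun P => h P.1 P.2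

theorem sigma_twistedConv (f g : C_c(G, A)) :
    R.sigma μ (D.twistedConv μ f g) ≤ R.sigma μ f * R.sigma μ g :=
  R.sigma_le μ fun P hP => by
    rw [BanachDynamicalSystem.integratedForm_twistedConv]
    exact (norm_mul_le _ _).trans (mul_le_mul (R.norm_integratedForm_le_sigma μ f hP)
      (R.norm_integratedForm_le_sigma μ g hP) (norm_nonneg _) (apply_nonneg _ _))

theorem exists_sigma_iA_le (a : A) :
    ∃ C, ∀ f, R.sigma μ (BanachDynamicalSystem.iA (G := G) a f) ≤ C * R.sigma μ f := by
  obtain ⟨C, ν, hC, hν, hK, h⟩ := R.uniformly_bounded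
  refine ⟨C * ‖a‖, fun f => R.sigma_le μ fun P hP => ?_⟩
  rw [BanachDynamicalSystem.integratedForm_iA]
  exact (norm_mul_le _ _).trans (mul_le_mul ((h P hP).1 a)
    (R.norm_integratedForm_le_sigma μ f hP) (norm_nonneg _) (by positivity))

theorem exists_sigma_iG_le (r : G) :
    ∃ C, ∀ f, R.sigma μ (D.iG r f) ≤ C * R.sigma μ f := by
  obtain ⟨C, ν, hC, hν, hK, h⟩ := R.uniformly_bounded
  refine ⟨ν r, fun f => R.sigma_le μ fun P hP => ?_⟩
  rw [BanachDynamicalSystem.integratedForm_iG]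
  exact (norm_mul_le _ _).trans (mul_le_mul ((h P hP).2 r)
    (R.norm_integratedForm_le_sigma μ f hP) (norm_nonneg _) (hν r))

/-- The space `C_c(G, A)` as a seminormed algebra, with twisted convolution as product and with
the seminorm `σ^R`. -/
def PreCrossedProduct (_R : UniformlyBoundedClass.{u, v, w} D) (_μ : Measure G) : Type (max u v) :=
  C_c(G, A)

instance : AddCommGroup (R.PreCrossedProduct μ) := inferInstanceAs (AddCommGroup C_c(G, A))

instance : Module ℝ (R.PreCrossedProduct μ) := inferInstanceAs (Module ℝ C_c(G, A))

/-- The identity map from `C_c(G, A)`. -/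
def toPre : C_c(G, A) ≃ₗ[ℝ] R.PreCrossedProduct μ := LinearEquiv.refl ℝ _

instance : SeminormedAddCommGroup (R.PreCrossedProduct μ) :=
  AddGroupSeminorm.toSeminormedAddCommGroup
    ((R.sigma μ).comp (R.toPre μ).symm.toLinearMap).toAddGroupSeminorm

theorem norm_toPre (f : C_c(G, A)) : ‖R.toPre μ f‖ = R.sigma μ f := rfl

instance : NormedSpace ℝ (R.PreCrossedProduct μ) where
  norm_smul_le c f := (map_smul_eq_mul (R.sigma μ) c f).le

instance : NonUnitalSeminormedRing (R.PreCrossedProduct μ) where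
  __ : SeminormedAddCommGroup (R.PreCrossedProduct μ) := inferInstance
  mul f g := R.toPre μ (D.twistedConv μ ((R.toPre μ).symm f) ((R.toPre μ).symm g))
  left_distrib f g h := D.twistedConv_add μ f g h
  right_distrib f g h := D.add_twistedConv μ f g h
  zero_mul f := by
    have := D.smul_twistedConv μ 0 (0 : C_c(G, A)) f
    rw [zero_smul, zero_smul] at this
    exact this
  mul_zero f := by
    have := D.twistedConv_smul μ 0 f (0 : C_c(G, A))
    rw [zero_smul, zero_smul] at this
    exact this
  mul_assoc f g h := D.twistedConv_assoc μ f g h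
  norm_mul_le f g := R.sigma_twistedConv μ f g

theorem toPre_twistedConv (f g : C_c(G, A)) :
    R.toPre μ (D.twistedConv μ f g) = R.toPre μ f * R.toPre μ g := rfl

instance : IsScalarTower ℝ (R.PreCrossedProduct μ) (R.PreCrossedProduct μ) :=
  ⟨fun c f g => D.smul_twistedConv μ c f g⟩

instance : SMulCommClass ℝ (R.PreCrossedProduct μ) (R.PreCrossedProduct μ) :=
  ⟨fun c f g => (D.twistedConv_smul μ c f g).symm⟩

/-- The crossed product `(A ⋊_α G)^R`: the (Hausdorff) completion of the seminormed algebra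
`C_c(G, A)` with the seminorm `σ^R`, that is, the completion of the normed algebra
`C_c(G, A) / ker σ^R`. -/
def CrossedProduct : Type (max u v) := UniformSpace.Completion (R.PreCrossedProduct μ)

instance : NormedAddCommGroup (R.CrossedProduct μ) :=
  inferInstanceAs (NormedAddCommGroup (UniformSpace.Completion (R.PreCrossedProduct μ)))

instance : NormedSpace ℝ (R.CrossedProduct μ) :=
  inferInstanceAs (NormedSpace ℝ (UniformSpace.Completion (R.PreCrossedProduct μ)))

instance : CompleteSpace (R.CrossedProduct μ) :=
  inferInstanceAs (CompleteSpace (UniformSpace.Completion (R.PreCrossedProduct μ)))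

/-- The canonical isometry from the seminormed algebra `C_c(G, A)` into the crossed product. -/
def preQ : R.PreCrossedProduct μ →L[ℝ] R.CrossedProduct μ :=
  UniformSpace.Completion.toComplL (𝕜 := ℝ) (E := R.PreCrossedProduct μ)

/-- The canonical map `q^R : C_c(G, A) → (A ⋊_α G)^R`. -/
def q : C_c(G, A) →ₗ[ℝ] R.CrossedProduct μ := (R.preQ μ).toLinearMap ∘ₗ (R.toPre μ).toLinearMap

theorem denseRange_preQ : DenseRange (R.preQ μ) :=
  UniformSpace.Completion.denseRange_coe (α := R.PreCrossedProduct μ)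

theorem isUniformInducing_preQ : IsUniformInducing (R.preQ μ) :=
  UniformSpace.Completion.isUniformInducing_coe (R.PreCrossedProduct μ)

theorem isDenseInducing_preQ : IsDenseInducing (R.preQ μ) :=
  UniformSpace.Completion.isDenseInducing_coe (α := R.PreCrossedProduct μ)

theorem norm_preQ (f : R.PreCrossedProduct μ) : ‖R.preQ μ f‖ = ‖f‖ :=
  UniformSpace.Completion.norm_coe f

theorem norm_q (f : C_c(G, A)) : ‖R.q μ f‖ = R.sigma μ f := R.norm_preQ μ _

theorem denseRange_q : DenseRange (R.q μ) := R.denseRange_preQ μ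

/-- The product of the crossed product is the continuous extension of twisted convolution. -/
instance : Mul (R.CrossedProduct μ) :=
  ⟨fun a b => ((R.isDenseInducing_preQ μ).prodMap (R.isDenseInducing_preQ μ)).extend
    (fun p : R.PreCrossedProduct μ × R.PreCrossedProduct μ => R.preQ μ (p.1 * p.2)) (a, b)⟩

theorem preQ_mul (f g : R.PreCrossedProduct μ) :
    R.preQ μ (f * g) = R.preQ μ f * R.preQ μ g :=
  (((R.isDenseInducing_preQ μ).prodMap (R.isDenseInducing_preQ μ)).extend_eq
    ((R.preQ μ).continuous.comp continuous_mul) (f, g)).symm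

instance : ContinuousMul (R.CrossedProduct μ) where
  continuous_mul := by
    let m := (AddMonoidHom.mul : R.PreCrossedProduct μ →+ _ →+ R.PreCrossedProduct μ).compr₂
      (R.preQ μ : R.PreCrossedProduct μ →+ R.CrossedProduct μ)
    have h : Continuous fun p : R.PreCrossedProduct μ × R.PreCrossedProduct μ => m p.1 p.2 :=
      (R.preQ μ).continuous.comp continuous_mul
    have di : IsDenseInducing
      ((R.preQ μ : R.PreCrossedProduct μ →+ R.CrossedProduct μ)) := R.isDenseInducing_preQ μ
    exact di.extend_Z_bilin di h

variable {R μ} in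
theorem induction₁ {p : R.CrossedProduct μ → Prop} (a : R.CrossedProduct μ)
    (hp : IsClosed {a | p a}) (h : ∀ f, p (R.preQ μ f)) : p a :=
  UniformSpace.Completion.induction_on a hp h

variable {R μ} in
theorem induction₂ {p : R.CrossedProduct μ → R.CrossedProduct μ → Prop}
    (a b : R.CrossedProduct μ)
    (hp : IsClosed {x : R.CrossedProduct μ × R.CrossedProduct μ | p x.1 x.2})
    (h : ∀ f g, p (R.preQ μ f) (R.preQ μ g)) : p a b :=
  UniformSpace.Completion.induction_on₂ a b hp h

variable {R μ} in
theorem induction₃ {p : R.CrossedProduct μ → R.CrossedProduct μ → R.CrossedProduct μ → Prop}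
    (a b c : R.CrossedProduct μ)
    (hp : IsClosed {x : R.CrossedProduct μ × R.CrossedProduct μ × R.CrossedProduct μ |
      p x.1 x.2.1 x.2.2})
    (h : ∀ f g k, p (R.preQ μ f) (R.preQ μ g) (R.preQ μ k)) : p a b c :=
  UniformSpace.Completion.induction_on₃ a b c hp h

theorem crossed_mul_add (a b c : R.CrossedProduct μ) : a * (b + c) = a * b + a * c :=
  induction₃ (p := fun a b c => a * (b + c) = a * b + a * c) a b c
    (isClosed_eq (by fun_prop) (by fun_prop))
    fun f g k => by rw [← map_add, ← preQ_mul, ← preQ_mul, ← preQ_mul, ← map_add, mul_add]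

theorem crossed_add_mul (a b c : R.CrossedProduct μ) : (a + b) * c = a * c + b * c :=
  induction₃ (p := fun a b c => (a + b) * c = a * c + b * c) a b c
    (isClosed_eq (by fun_prop) (by fun_prop))
    fun f g k => by rw [← map_add, ← preQ_mul, ← preQ_mul, ← preQ_mul, ← map_add, add_mul]

theorem crossed_zero_mul (a : R.CrossedProduct μ) : 0 * a = 0 :=
  induction₁ (p := fun a => 0 * a = 0) a (isClosed_eq (by fun_prop) (by fun_prop))
    fun f => by rw [← map_zero (R.preQ μ), ← preQ_mul, zero_mul]

theorem crossed_mul_zero (a : R.CrossedProduct μ) : a * 0 = 0 :=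
  induction₁ (p := fun a => a * 0 = 0) a (isClosed_eq (by fun_prop) (by fun_prop))
    fun f => by rw [← map_zero (R.preQ μ), ← preQ_mul, mul_zero]

theorem crossed_mul_assoc (a b c : R.CrossedProduct μ) : a * b * c = a * (b * c) :=
  induction₃ (p := fun a b c => a * b * c = a * (b * c)) a b c
    (isClosed_eq (by fun_prop) (by fun_prop))
    fun f g k => by rw [← preQ_mul, ← preQ_mul, ← preQ_mul, ← preQ_mul, mul_assoc]

theorem crossed_norm_mul_le (a b : R.CrossedProduct μ) : ‖a * b‖ ≤ ‖a‖ * ‖b‖ :=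
  induction₂ (p := fun a b => ‖a * b‖ ≤ ‖a‖ * ‖b‖) a b
    (isClosed_le (by fun_prop) (by fun_prop)) fun f g => by
      rw [← preQ_mul, norm_preQ, norm_preQ, norm_preQ]
      exact norm_mul_le f g

instance : NonUnitalNormedRing (R.CrossedProduct μ) where
  __ : NormedAddCommGroup (R.CrossedProduct μ) := inferInstance
  __ : Mul (R.CrossedProduct μ) := inferInstance
  left_distrib := R.crossed_mul_add μ
  right_distrib := R.crossed_add_mul μ
  zero_mul := R.crossed_zero_mul μ
  mul_zero := R.crossed_mul_zero μ
  mul_assoc := R.crossed_mul_assoc μ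
  norm_mul_le := R.crossed_norm_mul_le μ

theorem q_twistedConv (f g : C_c(G, A)) :
    R.q μ (D.twistedConv μ f g) = R.q μ f * R.q μ g := R.preQ_mul μ _ _

instance : IsScalarTower ℝ (R.CrossedProduct μ) (R.CrossedProduct μ) :=
  ⟨fun c a b => induction₂ (p := fun a b => (c • a) • b = c • (a • b)) a b
    (isClosed_eq (((continuous_const_smul c).comp continuous_fst).mul continuous_snd)
      ((continuous_const_smul c).comp continuous_mul))
    fun f g => by
      rw [smul_eq_mul, smul_eq_mul, ← map_smul, ← preQ_mul, ← preQ_mul, ← map_smul,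
        smul_mul_assoc]⟩

instance : SMulCommClass ℝ (R.CrossedProduct μ) (R.CrossedProduct μ) :=
  ⟨fun c a b => induction₂ (p := fun a b => c • (a • b) = a • (c • b)) a b
    (isClosed_eq ((continuous_const_smul c).comp continuous_mul)
      (continuous_fst.mul ((continuous_const_smul c).comp continuous_snd)))
    fun f g => by
      rw [smul_eq_mul, smul_eq_mul, ← map_smul, ← preQ_mul, ← preQ_mul, ← map_smul,
        mul_smul_comm]⟩

/-- The bounded linear map `T^R` on the crossed product induced by a linear map `T` on `C_c(G, A)`
that is bounded with respect to `σ^R`; it satisfies `T^R (q^R f) = T f`. -/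
def induced {Y : Type*} [NormedAddCommGroup Y] [NormedSpace ℝ Y] [CompleteSpace Y]
    (T : C_c(G, A) →ₗ[ℝ] Y) (hT : ∃ C, ∀ f, ‖T f‖ ≤ C * R.sigma μ f) :
    R.CrossedProduct μ →L[ℝ] Y :=
  (LinearMap.mkContinuousOfExistsBound (T ∘ₗ (R.toPre μ).symm.toLinearMap) hT).extend (R.preQ μ)

theorem induced_q {Y : Type*} [NormedAddCommGroup Y] [NormedSpace ℝ Y] [CompleteSpace Y]
    (T : C_c(G, A) →ₗ[ℝ] Y) (hT : ∃ C, ∀ f, ‖T f‖ ≤ C * R.sigma μ f) (f : C_c(G, A)) :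
    R.induced μ T hT (R.q μ f) = T f :=
  ContinuousLinearMap.extend_eq _ (R.denseRange_preQ μ) (R.isUniformInducing_preQ μ) _

/-- The operator on the crossed product induced by an operator `E` on `C_c(G, A)` that is bounded
with respect to `σ^R` and that satisfies `E (f * g) = (E f) * g`; it is a left centralizer. -/
def inducedCentralizer (E : C_c(G, A) →ₗ[ℝ] C_c(G, A))
    (hE : ∃ C, ∀ f, R.sigma μ (E f) ≤ C * R.sigma μ f)
    (hmul : ∀ f g, E (D.twistedConv μ f g) = D.twistedConv μ (E f) g) :
    leftCentralizerAlgebra (R.CrossedProduct μ) :=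
  ⟨R.induced μ (R.q μ ∘ₗ E) (hE.imp fun C h f => by simpa [norm_q] using h f), by
    intro a b
    set S := R.induced μ (R.q μ ∘ₗ E) (hE.imp fun C h f => by simpa [norm_q] using h f) with hS
    refine induction₂ (p := fun a b => S (a * b) = S a * b) a b
      (isClosed_eq (by fun_prop) (by fun_prop)) fun f g => ?_
    change S (R.q μ ((R.toPre μ).symm f) * R.q μ ((R.toPre μ).symm g)) =
      S (R.q μ ((R.toPre μ).symm f)) * R.q μ ((R.toPre μ).symm g)
    rw [← q_twistedConv, hS, induced_q, induced_q]
    simp only [LinearMap.comp_apply]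
    rw [hmul, q_twistedConv]⟩

/-- The map `i_A^R` from `A` to the left centralizer algebra of the crossed product. -/
def iA (a : A) : leftCentralizerAlgebra (R.CrossedProduct μ) :=
  R.inducedCentralizer μ (BanachDynamicalSystem.iA a) (R.exists_sigma_iA_le μ a)
    (D.iA_twistedConv μ a)

/-- The map `i_G^R` from `G` to the left centralizer algebra of the crossed product. -/
def iG (r : G) : leftCentralizerAlgebra (R.CrossedProduct μ) :=
  R.inducedCentralizer μ (D.iG r) (R.exists_sigma_iG_le μ r) (D.iG_twistedConv μ r)

theorem iA_q (a : A) (f : C_c(G, A)) :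
    (R.iA μ a).1 (R.q μ f) = R.q μ (BanachDynamicalSystem.iA a f) := R.induced_q μ _ _ f

theorem iG_q (r : G) (f : C_c(G, A)) :
    (R.iG μ r).1 (R.q μ f) = R.q μ (D.iG r f) := R.induced_q μ _ _ f

end UniformlyBoundedClass

/-- A continuous covariant representation `(π, U)` is `R`-continuous if `π ⋊ U` is bounded with
respect to `σ^R`. -/
def ContinuousCovariantRep.IsRContinuous {D : BanachDynamicalSystem A G} {X : Type*}
    [NormedAddCommGroup X] [NormedSpace ℝ X] [CompleteSpace X] (P : ContinuousCovariantRep D X)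
    (R : UniformlyBoundedClass.{u, v, w} D) (μ : Measure G) [μ.IsHaarMeasure] : Prop :=
  ∃ C, ∀ f, ‖P.integratedForm μ f‖ ≤ C * R.sigma μ f

/-- The representation `(π ⋊ U)^R` of the crossed product induced by an `R`-continuous covariant
representation `(π, U)`. -/
def ContinuousCovariantRep.crossed {D : BanachDynamicalSystem A G} {X : Type*}
    [NormedAddCommGroup X] [NormedSpace ℝ X] [CompleteSpace X] (P : ContinuousCovariantRep D X)
    {R : UniformlyBoundedClass.{u, v, w} D} {μ : Measure G} [μ.IsHaarMeasure]
    (hP : P.IsRContinuous R μ) : R.CrossedProduct μ →ₙₐ[ℝ] (X →L[ℝ] X) where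
  toFun := R.induced μ (P.integratedForm μ) hP
  map_smul' c a := map_smul _ c a
  map_zero' := map_zero _
  map_add' a b := map_add _ a b
  map_mul' a b := by
    set S := R.induced μ (P.integratedForm μ) hP with hS
    refine UniformlyBoundedClass.induction₂ (p := fun a b => S (a * b) = S a * S b) a b
      (isClosed_eq (by fun_prop) (by fun_prop)) fun f g => ?_
    change S (R.q μ ((R.toPre μ).symm f) * R.q μ ((R.toPre μ).symm g)) =
      S (R.q μ ((R.toPre μ).symm f)) * S (R.q μ ((R.toPre μ).symm g))
    have key : ∀ h, S (R.q μ h) = P.integratedForm μ h := R.induced_q μ (P.integratedForm μ) hP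
    rw [← R.q_twistedConv, key, key, key, BanachDynamicalSystem.integratedForm_twistedConv]

theorem ContinuousCovariantRep.crossed_q {D : BanachDynamicalSystem A G} {X : Type*}
    [NormedAddCommGroup X] [NormedSpace ℝ X] [CompleteSpace X] (P : ContinuousCovariantRep D X)
    {R : UniformlyBoundedClass.{u, v, w} D} {μ : Measure G} [μ.IsHaarMeasure]
    (hP : P.IsRContinuous R μ) (f : C_c(G, A)) :
    P.crossed hP (R.q μ f) = P.integratedForm μ f := R.induced_q μ _ hP f

/-- The cone `C_c(G, A_+)` of `C_c(G, A)`. -/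
def PreorderedBanachDynamicalSystem.ccCone (D : PreorderedBanachDynamicalSystem A G) :
    PointedCone ℝ C_c(G, A) where
  carrier := {f | ∀ s, f s ∈ D.cone}
  add_mem' hf hg s := D.cone.add_mem (hf s) (hg s)
  zero_mem' _ := D.cone.zero_mem
  smul_mem' c _ hf s := Submodule.smul_mem D.cone c (hf s)

/-- The cone of the pre-ordered crossed product: the closure of `q^R(C_c(G, A_+))`. -/
def PreorderedBanachDynamicalSystem.crossedCone (D : PreorderedBanachDynamicalSystem A G)
    (R : UniformlyBoundedClass.{u, v, w} D.toBanachDynamicalSystem) (μ : Measure G)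
    [μ.IsHaarMeasure] : PointedCone ℝ (R.CrossedProduct μ) :=
  (D.ccCone.map (R.q μ)).closure

end Crossed

end

universe u v w x i

/-! Two facts carry the theorem. The first is about a normed algebra `B` with a bounded approximate
left identity `(e)` and a bounded non-degenerate representation `T` on a Banach space. Left
centralizers satisfy `L λ(b) = λ(L b)`, so an extension of `T` to them must satisfy `Tbar(L) T(b)x =
T(L b)x`, which determines it on a dense span. It exists because `T(L e) T(b)x = T(L(e b))x`
converges to `T(L b)x` while the operators `T(L e)` stay bounded (`exists_isCentralizerExtension`).
If the `e` lie in the cone and `K` is closed, positivity passes to the limit.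

The second fact is that `(i_A, i_G)` is itself a covariant representation on the crossed product,
and its integrated form is left multiplication: `q(f) b = ∫ i_A(f(r)) i_G(r) b dr`
(`integratedForm_regularRep`). It suffices to compare both sides under the members of `R`, since
these separate points by the definition of `σ`. It follows that `q(h ⊗ u_i)` is a bounded
approximate left identity as `h ≥ 0` of integral one concentrates at `1`, and it is positive when
the `u_i` are.

The correspondence then follows. A pair `(π, U)` is recovered from `T = (π ⋊ U)^R` because `T(i_A(a)
b) = π(a) T(b)`, and likewise for `i_G`. Conversely, applying `b ↦ T(b)y` to the integral formula
shows that the pair `(Tbar ∘ i_A, Tbar ∘ i_G)` integrates to `T` (`integratedForm_covariantRep`).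
Positivity of `(π ⋊ U)^R` rests on integrals of cone-valued functions staying in a closed cone
(`PointedCone.integral_mem`). -/

noncomputable section

/-! ### Strong limits of bounded families of operators -/

section Density

variable {X Y ι : Type*} [NormedAddCommGroup X] [NormedSpace ℝ X]
  [NormedAddCommGroup Y] [NormedSpace ℝ Y] {l : Filter ι} {F : ι → X →L[ℝ] Y} {s : Set X}

/-- An eventually bounded family of operators that converges pointwise on a set with dense span
to an operator converges pointwise everywhere. -/
theorem tendsto_apply_of_dense_span {F' : X →L[ℝ] Y}
    (hs : Dense (Submodule.span ℝ s : Set X)) (hF : ∃ M, ∀ᶠ i in l, ‖F i‖ ≤ M)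
    (h : ∀ x ∈ s, Tendsto (fun i => F i x) l (𝓝 (F' x))) (x : X) :
    Tendsto (fun i => F i x) l (𝓝 (F' x)) := by
  have hspan : ∀ z ∈ Submodule.span ℝ s, Tendsto (fun i => F i z) l (𝓝 (F' z)) := by
    intro z hz
    induction hz using Submodule.span_induction with
    | mem z hz => exact h z hz
    | zero => simpa using tendsto_const_nhds
    | add y z _ _ hy hz => simpa using hy.add hz
    | smul c z _ hz => simpa using hz.const_smul c
  obtain ⟨M, hM⟩ := hF
  rw [Metric.tendsto_nhds]
  intro ε hε
  -- `N` bounds `‖F i - F'‖`; the summand 1 keeps it positive when both norms vanish.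
  set N := max M 0 + ‖F'‖ + 1 with hN
  have hNpos : 0 < N := by positivity
  obtain ⟨z, hz, hxz⟩ := Metric.dense_iff.1 hs x (ε / (2 * N)) (by positivity)
  have hxz' : ‖x - z‖ < ε / (2 * N) := by
    rw [← dist_eq_norm, dist_comm]
    exact hz
  filter_upwards [hM, Metric.tendsto_nhds.1 (hspan z hxz) (ε / 2) (by positivity)] with i hi hiz
  rw [dist_eq_norm] at hiz ⊢
  have e : F i x - F' x = (F i - F') (x - z) + (F i z - F' z) := by
    simp only [map_sub, sub_apply]
    abel
  have h1 : ‖F i - F'‖ ≤ N := by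
    refine (norm_sub_le _ _).trans ?_
    have := le_max_left M 0
    linarith
  have h2 : ‖(F i - F') (x - z)‖ ≤ ε / 2 := by
    calc _ ≤ N * (ε / (2 * N)) := (F i - F').le_of_opNorm_le_of_le h1 hxz'.le
      _ = ε / 2 := by field_simp
  rw [e]
  exact (norm_add_le _ _).trans_lt (by linarith)

/-- An eventually bounded family of operators into a Banach space that converges pointwise on a
set with dense span converges pointwise to a bounded operator. -/
theorem exists_tendsto_of_dense_span [l.NeBot] [CompleteSpace Y]
    (hs : Dense (Submodule.span ℝ s : Set X)) {M : ℝ} (hM : ∀ᶠ i in l, ‖F i‖ ≤ M)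
    (h : ∀ x ∈ s, ∃ y, Tendsto (fun i => F i x) l (𝓝 y)) :
    ∃ F' : X →L[ℝ] Y, (∀ x, Tendsto (fun i => F i x) l (𝓝 (F' x))) ∧ ‖F'‖ ≤ M := by
  have hM0 : 0 ≤ M := by
    obtain ⟨i, hi⟩ := hM.exists
    exact (norm_nonneg _).trans hi
  have hspan : ∀ z ∈ Submodule.span ℝ s, ∃ y, Tendsto (fun i => F i z) l (𝓝 y) := by
    intro z hz
    induction hz using Submodule.span_induction with
    | mem z hz => exact h z hz
    | zero => exact ⟨0, by simp⟩
    | add y z _ _ hy hz =>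
      obtain ⟨y', hy⟩ := hy
      obtain ⟨z', hz⟩ := hz
      exact ⟨y' + z', by simpa using hy.add hz⟩
    | smul c z _ hz =>
      obtain ⟨z', hz⟩ := hz
      exact ⟨c • z', by simpa using hz.const_smul c⟩
  have hall : ∀ x, ∃ y, Tendsto (fun i => F i x) l (𝓝 y) := by
    intro x
    rw [← cauchy_map_iff_exists_tendsto]
    -- No limit at `x` is available yet. The values `F i x` are shown to be eventually within `ε /
    -- 2` of the limit at a nearby point `z` of the span, and completeness of `Y` does the rest.
    refine Metric.cauchy_iff.2 ⟨inferInstance, fun ε hε => ?_⟩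
    obtain ⟨z, hz, hxz⟩ := Metric.dense_iff.1 hs x (ε / (4 * (M + 1))) (by positivity)
    have hxz' : ‖x - z‖ < ε / (4 * (M + 1)) := by
      rw [← dist_eq_norm, dist_comm]
      exact hz
    obtain ⟨y, hy⟩ := hspan z hxz
    have hball : ∀ᶠ i in l, dist (F i x) y < ε / 2 := by
      filter_upwards [hM, Metric.tendsto_nhds.1 hy (ε / 4) (by positivity)] with i hi hiz
      rw [dist_eq_norm] at hiz ⊢
      have e : F i x - y = F i (x - z) + (F i z - y) := by
        rw [map_sub]
        abel
      have h2 : ‖F i (x - z)‖ ≤ ε / 4 := by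
        calc _ ≤ (M + 1) * (ε / (4 * (M + 1))) :=
              (F i).le_of_opNorm_le_of_le (hi.trans (by linarith)) hxz'.le
          _ = ε / 4 := by field_simp
      rw [e]
      exact (norm_add_le _ _).trans_lt (by linarith)
    refine ⟨_, image_mem_map hball, ?_⟩
    rintro _ ⟨i, hi, rfl⟩ _ ⟨j, hj, rfl⟩
    exact (dist_triangle_right _ _ y).trans_lt (by
      have h1 : dist (F i x) y < ε / 2 := hi
      have h2 : dist (F j x) y < ε / 2 := hj
      linarith)
  choose φ hφ using hall
  have hle : ∀ x, ‖φ x‖ ≤ M * ‖x‖ := fun x =>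
    le_of_tendsto (hφ x).norm (hM.mono fun i hi => (F i).le_of_opNorm_le hi x)
  let Φ : X →ₗ[ℝ] Y :=
    { toFun := φ
      map_add' := fun x y => tendsto_nhds_unique (hφ (x + y)) (by
        simpa using (hφ x).add (hφ y))
      map_smul' := fun c x => tendsto_nhds_unique (hφ (c • x)) (by
        simpa using (hφ x).const_smul c) }
  exact ⟨Φ.mkContinuous M hle, hφ, Φ.mkContinuous_norm_le hM0 hle⟩

end Density

/-! ### Extension of representations to left centralizers -/

section Centralizer

set_option linter.unusedSectionVars false

variable {B X : Type*} [NonUnitalNormedRing B] [NormedSpace ℝ B]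
  [NormedAddCommGroup X] [NormedSpace ℝ X]

/-- Operators that agree on the range of a non-degenerate representation are equal. -/
theorem IsNondegenerateRep.ext {S : Type*} {T : S → X →L[ℝ] X} (hT : IsNondegenerateRep T)
    {V W : X →L[ℝ] X} (h : ∀ b x, V (T b x) = W (T b x)) : V = W := by
  refine ContinuousLinearMap.ext_on hT ?_
  rintro _ ⟨b, x, rfl⟩
  exact h b x

theorem IsNondegenerateRep.tendsto {S ι : Type*} {T : S → X →L[ℝ] X} (hT : IsNondegenerateRep T)
    {l : Filter ι} {F : ι → X →L[ℝ] X} {F' : X →L[ℝ] X} (hF : ∃ M, ∀ᶠ i in l, ‖F i‖ ≤ M)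
    (h : ∀ b x, Tendsto (fun i => F i (T b x)) l (𝓝 (F' (T b x)))) (x : X) :
    Tendsto (fun i => F i x) l (𝓝 (F' x)) := by
  refine tendsto_apply_of_dense_span hT hF ?_ x
  rintro _ ⟨b, x, rfl⟩
  exact h b x

/-- Membership in the closure suffices, so non-degeneracy can be transferred by exhibiting `T b x`
merely as a limit of vectors `T' b' x'`. -/
theorem IsNondegenerateRep.mono {S S' : Type*} {T : S → X →L[ℝ] X} {T' : S' → X →L[ℝ] X}
    (hT : IsNondegenerateRep T)
    (h : ∀ b x, T b x ∈ closure (Submodule.span ℝ {y : X | ∃ b x, y = T' b x} : Set X)) :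
    IsNondegenerateRep T' := by
  have h' : Submodule.span ℝ {y : X | ∃ b x, y = T b x} ≤
      (Submodule.span ℝ {y : X | ∃ b x, y = T' b x}).topologicalClosure := by
    refine Submodule.span_le.2 ?_
    rintro _ ⟨b, x, rfl⟩
    exact h b x
  exact dense_closure.1 (Dense.mono h' hT)

variable {T : B →ₙₐ[ℝ] (X →L[ℝ] X)}

theorem NonUnitalAlgHom.mul_apply_apply {S : Type*} [NonUnitalNonAssocSemiring S] [Module ℝ S]
    (T : S →ₙₐ[ℝ] (X →L[ℝ] X)) (a b : S) (x : X) : T (a * b) x = T a (T b x) := by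
  rw [map_mul]
  rfl

theorem norm_apply_le_of_isBoundedRep (hb : IsBoundedRep T) :
    ∃ C, 0 ≤ C ∧ ∀ b, ‖T b‖ ≤ C * ‖b‖ := by
  obtain ⟨C, hC⟩ := hb
  exact ⟨max C 0, le_max_right _ _, fun b =>
    (hC b).trans (mul_le_mul_of_nonneg_right (le_max_left _ _) (norm_nonneg _))⟩

theorem IsBoundedRep.continuous_apply (hb : IsBoundedRep T) (x : X) :
    Continuous fun b => T b x := by
  let Φ : B →L[ℝ] (X →L[ℝ] X) := LinearMap.mkContinuousOfExistsBound
    { toFun := T, map_add' := map_add T, map_smul' := map_smul T } hb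
  exact (Φ.flip x).continuous

variable [IsScalarTower ℝ B B] [SMulCommClass ℝ B B]

/-- This makes the image of `B` a left ideal in its left centralizer algebra, which is why an
extension of a non-degenerate representation of `B` has no freedom. -/
theorem mul_leftRegular (L : leftCentralizerAlgebra B) (b : B) :
    L * leftRegular b = leftRegular (L.1 b) := by
  refine Subtype.ext (ContinuousLinearMap.ext fun c => ?_)
  exact L.2 b c

variable (B) in
/-- The representation of the left centralizer algebra of `B` on `B`. -/
def centralizerInclusion : leftCentralizerAlgebra B →ₙₐ[ℝ] (B →L[ℝ] B) where
  toFun L := L.1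
  map_smul' _ _ := rfl
  map_zero' := rfl
  map_add' _ _ := rfl
  map_mul' _ _ := rfl

variable (B) in
theorem isBoundedRep_centralizerInclusion : IsBoundedRep (centralizerInclusion B) :=
  ⟨1, fun L => (one_mul ‖L.1‖).ge⟩

theorem norm_centralizer_apply_le {S : leftCentralizerAlgebra B →ₙₐ[ℝ] (X →L[ℝ] X)}
    (hS : IsBoundedRep S) : ∃ C, 0 ≤ C ∧ ∀ L, ‖S L‖ ≤ C * ‖L.1‖ := by
  obtain ⟨C, hC⟩ := hS
  exact ⟨max C 0, le_max_right _ _, fun L =>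
    (hC L).trans (mul_le_mul_of_nonneg_right (le_max_left _ _) (norm_nonneg _))⟩

/-- On a vector `T b y` the centralizer identity turns `T (L e) (T b y)` into `T (L (e b)) y`, which
converges since `e b → b`. The bound on `e` carries this over to all `x`. -/
theorem centralizer_tendsto (hT : IsNondegenerateRep T) (hb : IsBoundedRep T)
    {Tbar : leftCentralizerAlgebra B →ₙₐ[ℝ] (X →L[ℝ] X)}
    (h : ∀ L b x, Tbar L (T b x) = T (L.1 b) x)
    {l : Filter B} (hl : ∃ M : ℝ, ∀ᶠ e in l, ‖e‖ ≤ M)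
    (hl' : ∀ b, Tendsto (fun e => e * b) l (𝓝 b)) (L : leftCentralizerAlgebra B) (x : X) :
    Tendsto (fun e => T (L.1 e) x) l (𝓝 (Tbar L x)) := by
  obtain ⟨M, hM⟩ := hl
  obtain ⟨C, hC0, hC⟩ := norm_apply_le_of_isBoundedRep hb
  refine hT.tendsto ⟨C * (‖L.1‖ * M), hM.mono fun e he => (hC _).trans ?_⟩ (fun b y => ?_) x
  · gcongr
    exact L.1.le_opNorm_of_le he
  · rw [h]
    have := ((hb.continuous_apply y).comp L.1.continuous).continuousAt.tendsto.comp (hl' b)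
    refine this.congr fun e => ?_
    change T (L.1 (e * b)) y = _
    rw [L.2, T.mul_apply_apply]

/-- A bounded representation `Tbar` of the left centralizer algebra with `Tbar L ∘ T b = T (L b)`
is the canonical extension of the non-degenerate representation `T`. -/
theorem isCentralizerExtension_of_apply (hT : IsNondegenerateRep T) (hb : IsBoundedRep T)
    {Tbar : leftCentralizerAlgebra B →ₙₐ[ℝ] (X →L[ℝ] X)} (hbar : IsBoundedRep Tbar)
    (h : ∀ L b x, Tbar L (T b x) = T (L.1 b) x) : IsCentralizerExtension T Tbar := by
  have hreg : ∀ b, Tbar (leftRegular b) = T b := fun b => hT.ext fun c x => by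
    rw [h, ← T.mul_apply_apply]
    rfl
  refine ⟨hreg, fun S hS => ?_, ?_, hbar, fun l hl hl' => centralizer_tendsto hT hb h hl hl'⟩
  -- Uniqueness is purely algebraic on the vectors `T b x`: the operator `S L` is already bounded,
  -- and no bound on `S` as a map is needed.
  · refine NonUnitalAlgHom.ext fun L => hT.ext fun b x => ?_
    rw [h, ← hS b, ← S.mul_apply_apply, mul_leftRegular, hS]
  · refine hT.mono fun b x => subset_closure (Submodule.subset_span ⟨leftRegular b, x, ?_⟩)
    rw [hreg]

/-- The working description of the extension: it needs only multiplicativity and the left ideal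
property. -/
theorem IsCentralizerExtension.apply_apply {Tbar : leftCentralizerAlgebra B →ₙₐ[ℝ] (X →L[ℝ] X)}
    (h : IsCentralizerExtension T Tbar) (L : leftCentralizerAlgebra B) (b : B) (x : X) :
    Tbar L (T b x) = T (L.1 b) x := by
  rw [← h.apply_leftRegular b, ← Tbar.mul_apply_apply, mul_leftRegular, h.apply_leftRegular]

/-- The operators are taken as the strong limits of `T (L e)`. The algebraic laws need no
manipulation of limits: they are read off from the explicit value `T (L b) x` on the vectors `T b
x`. -/
theorem exists_isCentralizerExtension [CompleteSpace X] (hT : IsNondegenerateRep T)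
    (hb : IsBoundedRep T) {l : Filter B} [l.NeBot] (hl : ∃ M : ℝ, ∀ᶠ e in l, ‖e‖ ≤ M)
    (hl' : ∀ b, Tendsto (fun e => e * b) l (𝓝 b)) :
    ∃ Tbar : leftCentralizerAlgebra B →ₙₐ[ℝ] (X →L[ℝ] X), IsCentralizerExtension T Tbar := by
  obtain ⟨M, hM⟩ := hl
  obtain ⟨C, hC0, hC⟩ := norm_apply_le_of_isBoundedRep hb
  have hlim : ∀ (L : leftCentralizerAlgebra B) (b : B) (y : X),
      Tendsto (fun e => T (L.1 e) (T b y)) l (𝓝 (T (L.1 b) y)) := by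
    intro L b y
    have := ((hb.continuous_apply y).comp L.1.continuous).continuousAt.tendsto.comp (hl' b)
    refine this.congr fun e => ?_
    change T (L.1 (e * b)) y = _
    rw [L.2, T.mul_apply_apply]
  have hex : ∀ L : leftCentralizerAlgebra B, ∃ F' : X →L[ℝ] X,
      (∀ x, Tendsto (fun e => T (L.1 e) x) l (𝓝 (F' x))) ∧ ‖F'‖ ≤ C * (‖L.1‖ * M) := by
    intro L
    refine exists_tendsto_of_dense_span hT (hM.mono fun e he => (hC _).trans ?_) ?_
    · gcongr
      exact L.1.le_opNorm_of_le he
    · rintro _ ⟨b, y, rfl⟩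
      exact ⟨_, hlim L b y⟩
  choose φ hφ hφn using hex
  have key : ∀ L b x, φ L (T b x) = T (L.1 b) x := fun L b x =>
    tendsto_nhds_unique (hφ L _) (hlim L b x)
  let Tbar : leftCentralizerAlgebra B →ₙₐ[ℝ] (X →L[ℝ] X) :=
    { toFun := φ
      map_smul' := fun c L => hT.ext fun b x => by
        change φ (c • L) (T b x) = c • φ L (T b x)
        rw [key, key]
        change T (c • L.1 b) x = _
        rw [map_smul]
        rfl
      map_zero' := hT.ext fun b x => by
        rw [key]
        change T 0 x = 0
        rw [map_zero]
        rfl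
      map_add' := fun L L' => hT.ext fun b x => by
        change φ (L + L') (T b x) = φ L (T b x) + φ L' (T b x)
        rw [key, key, key]
        change T (L.1 b + L'.1 b) x = _
        rw [map_add]
        rfl
      map_mul' := fun L L' => hT.ext fun b x => by
        change φ (L * L') (T b x) = φ L (φ L' (T b x))
        rw [key, key, key]
        rfl }
  refine ⟨Tbar, isCentralizerExtension_of_apply hT hb ⟨C * M, fun L => ?_⟩ key⟩
  refine (hφn L).trans (le_of_eq ?_)
  change C * (‖L‖ * M) = _
  ring

/-- The canonical extension of a positive representation is positive, if there is an approximate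
left identity in the cone. -/
theorem IsCentralizerExtension.positive {C : PointedCone ℝ B} {K : PointedCone ℝ X}
    (hK : IsClosed (K : Set X)) {Tbar : leftCentralizerAlgebra B →ₙₐ[ℝ] (X →L[ℝ] X)}
    (h : IsCentralizerExtension T Tbar) (hpos : IsPositiveRep C K T)
    {l : Filter B} [l.NeBot] (hl : ∃ M : ℝ, ∀ᶠ e in l, ‖e‖ ≤ M)
    (hl' : ∀ b, Tendsto (fun e => e * b) l (𝓝 b)) (hlC : ∀ᶠ e in l, e ∈ C) :
    IsPositiveRep (leftCentralizerCone C) K Tbar := fun L hL x hx =>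
  hK.mem_of_tendsto (h.tendsto l hl hl' L x) (hlC.mono fun e he => hpos _ (hL e he) x hx)

theorem IsCentralizerExtension.map_one {Tbar : leftCentralizerAlgebra B →ₙₐ[ℝ] (X →L[ℝ] X)}
    (h : IsCentralizerExtension T Tbar) (hT : IsNondegenerateRep T) : Tbar 1 = 1 :=
  hT.ext fun b x => by
    rw [h.apply_apply]
    rfl

end Centralizer

/-! ### Approximate identities at the unit of `G`, and integrals in closed cones -/

section Dirac

set_option linter.unusedSectionVars false

variable {G : Type*} [Group G] [TopologicalSpace G] [MeasurableSpace G]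

/-- The continuous functions with values in `[0, ∞)`, with compact support contained in `V` and
with integral `1`. -/
def bumps (μ : Measure G) (V : Set G) : Set C_c(G, ℝ) :=
  {h | (∀ r, 0 ≤ h r) ∧ tsupport h ⊆ V ∧ ∫ r, h r ∂μ = 1}

theorem monotone_bumps (μ : Measure G) : Monotone (bumps μ) :=
  fun _ _ hV _ h => ⟨h.1, h.2.1.trans hV, h.2.2⟩

/-- The filter on `C_c(G, ℝ)` of an approximate identity that is concentrated at `1`. -/
def diracFilter (μ : Measure G) : Filter C_c(G, ℝ) := (𝓝 1).lift' (bumps μ)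

theorem eventually_mem_bumps (μ : Measure G) {V : Set G} (hV : V ∈ 𝓝 (1 : G)) :
    ∀ᶠ h in diracFilter μ, h ∈ bumps μ V := mem_lift' hV

variable [IsTopologicalGroup G] [LocallyCompactSpace G] [T2Space G] [BorelSpace G]
  (μ : Measure G) [μ.IsHaarMeasure]

theorem nonempty_bumps {V : Set G} (hV : V ∈ 𝓝 (1 : G)) : (bumps μ V).Nonempty := by
  -- A closed neighbourhood is needed in between: vanishing off its interior then places the whole
  -- topological support inside `V`.
  obtain ⟨W, hW, hWc, hWV⟩ := exists_mem_nhds_isClosed_subset hV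
  obtain ⟨f, hf1, hf0, hfc, hf⟩ := exists_continuous_one_zero_of_isCompact
    (isCompact_singleton (x := (1 : G))) (isOpen_interior (s := W)).isClosed_compl (by
      rw [Set.disjoint_singleton_left]
      exact fun h => h (mem_interior_iff_mem_nhds.2 hW))
  have hpos : 0 < ∫ r, f r ∂μ :=
    f.continuous.integral_pos_of_hasCompactSupport_nonneg_nonzero hfc (fun r => (hf r).1)
      (x := 1) (by simp [hf1 rfl])
  let g : C_c(G, ℝ) := ⟨f, hfc⟩
  refine ⟨(∫ r, f r ∂μ)⁻¹ • g, fun r => mul_nonneg (inv_nonneg.2 hpos.le) (hf r).1, ?_, ?_⟩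
  · refine subset_trans ?_ (hWV)
    refine closure_minimal (fun r hr => ?_) hWc
    by_contra hrW
    refine hr ?_
    change (∫ r, f r ∂μ)⁻¹ * f r = 0
    rw [hf0 (fun h => hrW (interior_subset h))]
    simp
  · change ∫ r, (∫ r, f r ∂μ)⁻¹ * f r ∂μ = 1
    rw [integral_const_mul, inv_mul_cancel₀ hpos.ne']

instance : (diracFilter μ).NeBot :=
  (lift'_neBot_iff (monotone_bumps μ)).2 fun _ hV => nonempty_bumps μ hV

theorem C_c.integrable_smul {Y : Type*} [NormedAddCommGroup Y] [NormedSpace ℝ Y]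
    (h : C_c(G, ℝ)) {k : G → Y} (hk : Continuous k) : Integrable (fun r => h r • k r) μ := by
  refine Continuous.integrable_of_hasCompactSupport (h.continuous.smul hk) ?_
  exact h.hasCompactSupport.mono fun r hr h0 => hr (by simp [h0])

/-- Integrals against an approximate identity converge to the value at `1`. -/
theorem tendsto_integral_diracFilter {Y : Type*} [NormedAddCommGroup Y] [NormedSpace ℝ Y]
    [CompleteSpace Y] {k : G → Y} (hk : Continuous k) :
    Tendsto (fun h : C_c(G, ℝ) => ∫ r, h r • k r ∂μ) (diracFilter μ) (𝓝 (k 1)) := by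
  rw [Metric.tendsto_nhds]
  intro ε hε
  have hV : {r | ‖k r - k 1‖ < ε / 2} ∈ 𝓝 (1 : G) := by
    have : Continuous fun r => ‖k r - k 1‖ := by fun_prop
    exact this.continuousAt.preimage_mem_nhds (Iio_mem_nhds (by simpa using half_pos hε))
  filter_upwards [eventually_mem_bumps μ hV] with h hh
  obtain ⟨h0, hsupp, h1⟩ := hh
  have hint : Integrable h μ := h.continuous.integrable_of_hasCompactSupport h.hasCompactSupport
  -- Since `h` has integral one, `k 1` can be written as the integral of `h r • k 1`.
  have e : ∫ r, h r • k r ∂μ - k 1 = ∫ r, h r • (k r - k 1) ∂μ := by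
    simp_rw [smul_sub]
    rw [integral_sub (C_c.integrable_smul μ h hk) (hint.smul_const _), integral_smul_const, h1,
      one_smul]
  rw [dist_eq_norm, e]
  calc _ ≤ ∫ r, h r * (ε / 2) ∂μ := by
        refine norm_integral_le_of_norm_le (hint.mul_const _) (Eventually.of_forall fun r => ?_)
        rw [norm_smul, Real.norm_of_nonneg (h0 r)]
        by_cases hr : r ∈ tsupport h
        · exact mul_le_mul_of_nonneg_left (hsupp hr).le (h0 r)
        · simp [image_eq_zero_of_notMem_tsupport hr]
    _ = ε / 2 := by rw [integral_mul_const, h1, one_mul]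
    _ < ε := half_lt_self hε

/-- The average of `k` over its support, a compact set of finite measure, lies in the closed convex
set `K`; the integral is a non-negative multiple of that average. A support of measure zero is
treated apart, because averages need positive measure. -/
theorem PointedCone.integral_mem {Y : Type*} [NormedAddCommGroup Y] [NormedSpace ℝ Y]
    [CompleteSpace Y] {K : PointedCone ℝ Y} (hK : IsClosed (K : Set Y)) {k : G → Y}
    (hk : Continuous k) (hc : HasCompactSupport k) (h : ∀ r, k r ∈ K) : ∫ r, k r ∂μ ∈ K := by
  by_cases h0 : μ (tsupport k) = 0
  · have : ∫ r, k r ∂μ = 0 := by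
      rw [← setIntegral_tsupport]
      exact setIntegral_measure_zero _ h0
    rw [this]
    exact K.zero_mem
  · have hfin : μ (tsupport k) ≠ ⊤ := hc.isCompact.measure_lt_top.ne
    have hav : ⨍ r in tsupport k, k r ∂μ ∈ (K : Set Y) :=
      (PointedCone.convex K).set_average_mem hK h0 hfin (Eventually.of_forall h)
        (hk.integrable_of_hasCompactSupport hc).integrableOn
    have : ∫ r, k r ∂μ = μ.real (tsupport k) • ⨍ r in tsupport k, k r ∂μ := by
      rw [measure_smul_setAverage _ hfin, setIntegral_tsupport]
    rw [this]
    exact K.smul_mem measureReal_nonneg hav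

end Dirac

/-! ### Integrated forms along elementary tensors -/

section Elementary

set_option linter.unusedSectionVars false

variable {A G X : Type*} [NonUnitalNormedRing A] [NormedSpace ℝ A]
  [Group G] [TopologicalSpace G] [NormedAddCommGroup X] [NormedSpace ℝ X]

/-- The function `r ↦ h(r) a`. -/
def elementaryTensor (h : C_c(G, ℝ)) (a : A) : C_c(G, A) where
  toFun r := h r • a
  continuous_toFun := h.continuous.smul continuous_const
  hasCompactSupport' := h.hasCompactSupport.mono fun r hr h0 => hr (by simp [h0])

theorem elementaryTensor_apply (h : C_c(G, ℝ)) (a : A) (r : G) :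
    elementaryTensor h a r = h r • a := rfl

theorem tsupport_elementaryTensor_subset (h : C_c(G, ℝ)) (a : A) :
    tsupport (elementaryTensor h a) ⊆ tsupport h :=
  closure_mono fun r hr h0 => hr (by simp [elementaryTensor_apply, h0])

namespace ContinuousCovariantRep

variable {D : BanachDynamicalSystem A G} (P : ContinuousCovariantRep D X)
  [IsTopologicalGroup G] [LocallyCompactSpace G] [T2Space G] [CompleteSpace X]
  [MeasurableSpace G] [BorelSpace G] (μ : Measure G) [μ.IsHaarMeasure]

theorem integratedForm_elementaryTensor (h : C_c(G, ℝ)) (a : A) (x : X) :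
    P.integratedForm μ (elementaryTensor h a) x = P.π a (∫ r, h r • P.U r x ∂μ) := by
  rw [← (P.π a).integral_comp_comm (C_c.integrable_smul μ h (P.continuous_apply x)),
    integratedForm_apply]
  congr 1
  ext r
  rw [elementaryTensor_apply, map_smul, map_smul]
  rfl

theorem tendsto_integratedForm_elementaryTensor (a : A) (x : X) :
    Tendsto (fun h => P.integratedForm μ (elementaryTensor h a) x) (diracFilter μ)
      (𝓝 (P.π a x)) := by
  simp_rw [integratedForm_elementaryTensor]
  have := tendsto_integral_diracFilter μ (P.continuous_apply x)
  rw [map_one] at this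
  exact ((P.π a).continuous.tendsto _).comp this

/-- The integrated form along an approximate identity in `C_c(G, A)`. -/
theorem tendsto_integratedForm_approxIdentity {I : Type*} {l : Filter I} {u : I → A}
    (hu : ∃ M : ℝ, ∀ i, ‖u i‖ ≤ M) {x : X} (hx : Tendsto (fun i => P.π (u i) x) l (𝓝 x)) :
    Tendsto (fun p : C_c(G, ℝ) × I => P.integratedForm μ (elementaryTensor p.1 (u p.2)) x)
      (diracFilter μ ×ˢ l) (𝓝 x) := by
  obtain ⟨M, hM⟩ := hu
  simp_rw [integratedForm_elementaryTensor]
  have h1 : Tendsto (fun h : C_c(G, ℝ) => ∫ r, h r • P.U r x ∂μ) (diracFilter μ) (𝓝 x) := by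
    have := tendsto_integral_diracFilter μ (P.continuous_apply x)
    rwa [map_one] at this
  -- The two indices move independently, so the smoothed vector is first replaced by `x`; the error
  -- is uniform in the second index because `u` is bounded. What remains is `π(u i) x`, which
  -- converges by hypothesis.
  have h2 : Tendsto (fun p : C_c(G, ℝ) × I => P.π (u p.2) ((∫ r, p.1 r • P.U r x ∂μ) - x))
      (diracFilter μ ×ˢ l) (𝓝 0) := by
    have h3 : Tendsto (fun p : C_c(G, ℝ) × I => ‖P.πL‖ * M * ‖(∫ r, p.1 r • P.U r x ∂μ) - x‖)
        (diracFilter μ ×ˢ l) (𝓝 0) := by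
      have := (((h1.comp (tendsto_fst (g := l))).sub_const x).norm).const_mul (‖P.πL‖ * M)
      simpa using this
    refine squeeze_zero_norm (fun p => ?_) h3
    refine (P.πL (u p.2)).le_of_opNorm_le ?_ _
    exact P.πL.le_opNorm_of_le (hM _)
  have h4 := h2.add (hx.comp tendsto_snd)
  rw [zero_add] at h4
  refine h4.congr fun p => ?_
  change P.π (u p.2) _ + P.π (u p.2) x = _
  rw [← map_add, sub_add_cancel]

/-- Each `π(a) x` is the limit of `(π ⋊ U)(h ⊗ a) x` as `h` concentrates at `1`. -/
theorem nondegenerate_integratedForm (hP : P.Nondegenerate) :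
    IsNondegenerateRep (P.integratedForm μ) :=
  IsNondegenerateRep.mono hP fun a x =>
    mem_closure_of_tendsto (P.tendsto_integratedForm_elementaryTensor μ a x)
      (Eventually.of_forall fun _ => Submodule.subset_span ⟨_, _, rfl⟩)

theorem integratedForm_positive {D : PreorderedBanachDynamicalSystem A G}
    {P : ContinuousCovariantRep D.toBanachDynamicalSystem X} {K : PointedCone ℝ X}
    (hK : IsClosed (K : Set X)) (hP : P.Positive K) {f : C_c(G, A)} (hf : ∀ r, f r ∈ D.cone) :
    P.integratedForm μ f ∈ operatorCone K := by
  intro x hx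
  rw [integratedForm_apply]
  refine PointedCone.integral_mem μ hK ?_ ?_ fun r => hP.1 _ (hf r) _ (hP.2 r x hx)
  · exact (P.continuous_integrand f (k := fun _ => x) continuous_const).comp
      (continuous_const.prodMk continuous_id : Continuous fun r : G => ((1 : G), r))
  · refine f.hasCompactSupport.mono ?_
    intro r hr h
    exact hr (by simp only [h, map_zero]; rfl)

end ContinuousCovariantRep

end Elementary

/-! ### The canonical pair `(i_A, i_G)` on the crossed product -/

section CrossedProduct

set_option linter.unusedSectionVars false

variable {A : Type u} {G : Type v} [NonUnitalNormedRing A] [NormedSpace ℝ A]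
  [IsScalarTower ℝ A A] [SMulCommClass ℝ A A] [CompleteSpace A]
  [Group G] [TopologicalSpace G] [IsTopologicalGroup G] [LocallyCompactSpace G] [T2Space G]
  [MeasurableSpace G] [BorelSpace G]

namespace UniformlyBoundedClass

variable {D : BanachDynamicalSystem A G} (R : UniformlyBoundedClass.{u, v, w} D)
  (μ : Measure G) [μ.IsHaarMeasure]

section Dense

variable {R μ} {Y : Type*} [NormedAddCommGroup Y] [NormedSpace ℝ Y]
  {S S' : R.CrossedProduct μ →L[ℝ] Y}

theorem clm_ext (h : ∀ f, S (R.q μ f) = S' (R.q μ f)) : S = S' :=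
  DFunLike.coe_injective
    ((R.denseRange_q μ).equalizer S.continuous S'.continuous (funext h))

theorem opNorm_le_of_q {C : ℝ} (hC : 0 ≤ C) (h : ∀ f, ‖S (R.q μ f)‖ ≤ C * R.sigma μ f) :
    ‖S‖ ≤ C :=
  S.opNorm_le_bound hC fun b => (R.denseRange_q μ).induction_on (p := fun b => ‖S b‖ ≤ C * ‖b‖) b
    (isClosed_le (by fun_prop) (by fun_prop)) fun f => by
      rw [norm_q]
      exact h f

theorem centralizer_ext {L L' : leftCentralizerAlgebra (R.CrossedProduct μ)}
    (h : ∀ f, L.1 (R.q μ f) = L'.1 (R.q μ f)) : L = L' := Subtype.ext (clm_ext h)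

end Dense

/-- The constants of the class `R` are inherited unchanged, since each of its members turns `i_A(a)`
and `i_G(r)` into composition with `π(a)` and `U r`. Having bounds uniform in `a` and locally
uniform in `r` is what the density arguments below require. -/
theorem exists_norm_centralizer_le : ∃ (C : ℝ) (ν : G → ℝ), 0 ≤ C ∧ (∀ r, 0 ≤ ν r) ∧
    (∀ K : Set G, IsCompact K → BddAbove (ν '' K)) ∧
    (∀ a, ‖(R.iA μ a).1‖ ≤ C * ‖a‖) ∧ ∀ r, ‖(R.iG μ r).1‖ ≤ ν r := by
  obtain ⟨C, ν, hC, hν, hK, h⟩ := R.uniformly_bounded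
  refine ⟨C, ν, hC, hν, hK, fun a => ?_, fun r => ?_⟩
  · refine opNorm_le_of_q (by positivity) fun f => ?_
    rw [iA_q, norm_q]
    refine R.sigma_le μ fun P hP => ?_
    rw [BanachDynamicalSystem.integratedForm_iA]
    exact (norm_mul_le _ _).trans (mul_le_mul ((h P hP).1 a)
      (R.norm_integratedForm_le_sigma μ f hP) (norm_nonneg _) (by positivity))
  · refine opNorm_le_of_q (hν r) fun f => ?_
    rw [iG_q, norm_q]
    refine R.sigma_le μ fun P hP => ?_
    rw [BanachDynamicalSystem.integratedForm_iG]
    exact (norm_mul_le _ _).trans (mul_le_mul ((h P hP).2 r)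
      (R.norm_integratedForm_le_sigma μ f hP) (norm_nonneg _) (hν r))

/-- On functions supported in a fixed compact set, `σ` is dominated by the `L¹` norm, because `ν` is
bounded there. -/
theorem exists_sigma_le_integral {K : Set G} (hK : IsCompact K) :
    ∃ c, 0 ≤ c ∧ ∀ f : C_c(G, A), tsupport f ⊆ K → R.sigma μ f ≤ c * ∫ r, ‖f r‖ ∂μ := by
  obtain ⟨C, ν, hC, hν, hb, h⟩ := R.uniformly_bounded
  obtain ⟨M, hM⟩ := hb K hK
  refine ⟨C * max M 0, by positivity, fun f hf => R.sigma_le μ fun P hP => ?_⟩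
  refine P.rep.norm_integratedForm_le μ f hC (h P hP).1 (le_max_right _ _) fun r hr => ?_
  exact ((h P hP).2 r).trans ((hM ⟨r, hf hr, rfl⟩).trans (le_max_left _ _))

/-- Uniform convergence with supports in a fixed compact set implies convergence in the crossed
product. -/
theorem tendsto_q {ι : Type*} {l : Filter ι} {f : ι → C_c(G, A)} {g : C_c(G, A)} {K : Set G}
    (hK : IsCompact K) (hf : ∀ᶠ i in l, tsupport (f i) ⊆ K) (hg : tsupport g ⊆ K)
    (h : ∀ ε > 0, ∀ᶠ i in l, ∀ s ∈ K, ‖f i s - g s‖ < ε) :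
    Tendsto (fun i => R.q μ (f i)) l (𝓝 (R.q μ g)) := by
  obtain ⟨c, hc, hσ⟩ := R.exists_sigma_le_integral μ hK
  rw [Metric.tendsto_nhds]
  intro ε hε
  -- Adding 1 makes `N` positive and also provides the strict inequality at the end of the estimate.
  set N := c * μ.real K + 1 with hN
  have hNpos : 0 < N := by positivity
  filter_upwards [hf, h (ε / N) (by positivity)] with i hi hiε
  have hzero : ∀ s, s ∉ K → (f i - g) s = 0 := by
    intro s hs
    change f i s - g s = 0
    rw [image_eq_zero_of_notMem_tsupport fun h => hs (hi h),
      image_eq_zero_of_notMem_tsupport fun h => hs (hg h), sub_zero]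
  have hsupp : tsupport (f i - g) ⊆ K :=
    closure_minimal (fun s hs => by_contra fun h => hs (hzero s h)) hK.isClosed
  have hint : ∫ r, ‖(f i - g) r‖ ∂μ ≤ ε / N * μ.real K := by
    rw [← setIntegral_eq_integral_of_forall_compl_eq_zero (s := K) fun s hs => by
      rw [hzero s hs, norm_zero]]
    refine (le_abs_self _).trans ?_
    refine norm_setIntegral_le_of_norm_le_const (μ := μ) (f := fun r => ‖(f i - g) r‖)
      hK.measure_lt_top fun s hs => ?_
    rw [norm_norm]
    exact (hiε s hs).le
  rw [dist_eq_norm, ← map_sub, norm_q]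
  calc _ ≤ c * (ε / N * μ.real K) := (hσ _ hsupp).trans (mul_le_mul_of_nonneg_left hint hc)
    _ = ε / N * (N - 1) := by rw [hN]; ring
    _ < ε / N * N := by
      have : 0 < ε / N := by positivity
      exact mul_lt_mul_of_pos_left (by linarith) this
    _ = ε := by field_simp

open scoped Pointwise in
-- By local boundedness it is enough to treat `b = q f`. For `r` in a compact neighbourhood `N` of
-- `r₀` the translates are supported in the compact set `N * tsupport f`, so uniform convergence
-- there suffices.
theorem continuous_iG_apply (b : R.CrossedProduct μ) :
    Continuous fun r => (R.iG μ r).1 b := by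
  rw [continuous_iff_continuousAt]
  intro r₀
  obtain ⟨N, hN, hr₀⟩ := exists_compact_mem_nhds r₀
  obtain ⟨C, ν, hC, hν, hb, -, hG⟩ := R.exists_norm_centralizer_le μ
  obtain ⟨M, hM⟩ := hb N hN
  refine tendsto_apply_of_dense_span (s := Set.range (R.q μ))
    ((R.denseRange_q μ).mono Submodule.subset_span)
    ⟨M, Filter.mem_of_superset hr₀ fun r hr => (hG r).trans (hM ⟨r, hr, rfl⟩)⟩ ?_ b
  rintro _ ⟨f, rfl⟩
  simp_rw [iG_q]
  have hK : IsCompact (N * tsupport f) := hN.mul f.hasCompactSupport.isCompact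
  have hsupp : ∀ r ∈ N, tsupport (D.iG r f) ⊆ N * tsupport f := by
    intro r hr
    refine closure_minimal (fun s hs => ?_) hK.isClosed
    refine ⟨r, hr, r⁻¹ * s, ?_, by simp⟩
    by_contra h
    refine hs ?_
    rw [BanachDynamicalSystem.iG_apply, image_eq_zero_of_notMem_tsupport h, map_zero]
  have hcont : Continuous fun p : G × G => D.α p.1 (f (p.1⁻¹ * p.2)) :=
    (continuous_uncurry_of_stronglyContinuous D.continuous_apply).comp
      (continuous_fst.prodMk (f.continuous.comp (by fun_prop)))
  have hdiff : Continuous fun p : G × G => ‖D.iG p.1 f p.2 - D.iG r₀ f p.2‖ :=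
    (hcont.sub ((D.iG r₀ f).continuous.comp continuous_snd)).norm
  refine R.tendsto_q μ hK (Filter.mem_of_superset hr₀ hsupp) (hsupp _ (mem_of_mem_nhds hr₀))
    fun ε hε => ?_
  -- Compactness in `s` (the tube lemma) makes the estimate uniform: the jointly continuous
  -- difference vanishes at every `(r₀, s)`.
  refine hK.eventually_forall_of_forall_eventually fun s _ => ?_
  exact hdiff.continuousAt.preimage_mem_nhds (Iio_mem_nhds (by simpa using hε))

/-- For `b = q f`, the pointwise convergence `u i * f s → f s` is uniform on the compact support,
because left multiplications by a bounded net are equicontinuous. -/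
theorem tendsto_iA_apply {I : Type*} {l : Filter I} {u : I → A} (hu : ∃ M : ℝ, ∀ i, ‖u i‖ ≤ M)
    (hu' : ∀ a, Tendsto (fun i => u i * a) l (𝓝 a)) (b : R.CrossedProduct μ) :
    Tendsto (fun i => (R.iA μ (u i)).1 b) l (𝓝 b) := by
  obtain ⟨M, hM⟩ := hu
  obtain ⟨C, ν, hC, hν, hb, hA, -⟩ := R.exists_norm_centralizer_le μ
  refine tendsto_apply_of_dense_span (s := Set.range (R.q μ))
    (F' := ContinuousLinearMap.id ℝ (R.CrossedProduct μ))
    ((R.denseRange_q μ).mono Submodule.subset_span)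
    ⟨C * M, Eventually.of_forall fun i =>
      (hA _).trans (mul_le_mul_of_nonneg_left (hM i) hC)⟩ ?_ b
  rintro _ ⟨f, rfl⟩
  simp_rw [iA_q]
  refine R.tendsto_q μ f.hasCompactSupport.isCompact (Eventually.of_forall fun i => ?_)
    subset_rfl fun ε hε => ?_
  · refine closure_mono fun s hs h => hs ?_
    rw [BanachDynamicalSystem.iA_apply, h, mul_zero]
  · refine f.hasCompactSupport.isCompact.induction_on
      (p := fun S => ∀ᶠ i in l, ∀ s ∈ S, ‖u i * f s - f s‖ < ε) (by simp)
      (fun S T hST hT => hT.mono fun i hi s hs => hi s (hST hs))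
      (fun S T hS hT => (hS.and hT).mono fun i hi s hs => hs.elim (hi.1 s) (hi.2 s))
      fun s₀ _ => ?_
    -- The three error terms contribute `|M|`, 1 and 1 times `ε / N`.
    set N := |M| + 2 with hN
    have hNpos : 0 < N := by positivity
    have hW : {s | ‖f s - f s₀‖ < ε / N} ∈ 𝓝 s₀ := by
      have : Continuous fun s => ‖f s - f s₀‖ := by
        have := f.continuous
        fun_prop
      refine this.continuousAt.preimage_mem_nhds (Iio_mem_nhds ?_)
      rw [sub_self, norm_zero]
      positivity
    refine ⟨_, mem_nhdsWithin_of_mem_nhds hW, ?_⟩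
    filter_upwards [Metric.tendsto_nhds.1 (hu' (f s₀)) (ε / N) (by positivity)] with i hi s hs
    rw [dist_eq_norm] at hi
    have hs' : ‖f s - f s₀‖ < ε / N := hs
    have e : u i * f s - f s = u i * (f s - f s₀) + (u i * f s₀ - f s₀) - (f s - f s₀) := by
      rw [mul_sub]
      abel
    have h1 : ‖u i * (f s - f s₀)‖ ≤ |M| * (ε / N) :=
      (norm_mul_le _ _).trans (mul_le_mul ((hM i).trans (le_abs_self M)) hs'.le (norm_nonneg _)
        (abs_nonneg M))
    rw [e]
    calc _ ≤ ‖u i * (f s - f s₀)‖ + ‖u i * f s₀ - f s₀‖ + ‖f s - f s₀‖ :=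
          (norm_sub_le _ _).trans (by gcongr; exact norm_add_le _ _)
      _ < |M| * (ε / N) + ε / N + ε / N := by linarith
      _ = ε / N * N := by rw [hN]; ring
      _ = ε := by field_simp

/-- `i_A^R` as a representation of `A` in the left centralizer algebra. -/
def iAHom : A →ₙₐ[ℝ] leftCentralizerAlgebra (R.CrossedProduct μ) where
  toFun := R.iA μ
  map_smul' c a := centralizer_ext fun f => by
    change _ = c • (R.iA μ a).1 (R.q μ f)
    rw [iA_q, iA_q, ← map_smul]
    congr 1
    ext s
    exact smul_mul_assoc c a (f s)
  map_zero' := centralizer_ext fun f => by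
    change _ = (0 : R.CrossedProduct μ)
    rw [iA_q, ← map_zero (R.q μ)]
    congr 1
    ext s
    exact zero_mul (f s)
  map_add' a b := centralizer_ext fun f => by
    change _ = (R.iA μ a).1 (R.q μ f) + (R.iA μ b).1 (R.q μ f)
    rw [iA_q, iA_q, iA_q, ← map_add]
    congr 1
    ext s
    exact add_mul a b (f s)
  map_mul' a b := centralizer_ext fun f => by
    change _ = (R.iA μ a).1 ((R.iA μ b).1 (R.q μ f))
    rw [iA_q, iA_q, iA_q]
    congr 1
    ext s
    exact mul_assoc a b (f s)

/-- `i_G^R` as a homomorphism from `G` to the left centralizer algebra. -/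
def iGHom : G →* leftCentralizerAlgebra (R.CrossedProduct μ) where
  toFun := R.iG μ
  map_one' := centralizer_ext fun f => by
    change _ = R.q μ f
    rw [iG_q]
    congr 1
    ext s
    rw [BanachDynamicalSystem.iG_apply, map_one, inv_one, one_mul]
    rfl
  map_mul' r t := centralizer_ext fun f => by
    change _ = (R.iG μ r).1 ((R.iG μ t).1 (R.q μ f))
    rw [iG_q, iG_q, iG_q]
    congr 1
    ext s
    rw [BanachDynamicalSystem.iG_apply, BanachDynamicalSystem.iG_apply,
      BanachDynamicalSystem.iG_apply, map_mul, mul_inv_rev, mul_assoc]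
    rfl

theorem iA_α (s : G) (a : A) : R.iA μ (D.α s a) = R.iG μ s * R.iA μ a * R.iG μ s⁻¹ :=
  centralizer_ext fun f => by
    change _ = (R.iG μ s).1 ((R.iA μ a).1 ((R.iG μ s⁻¹).1 (R.q μ f)))
    rw [iA_q, iG_q, iA_q, iG_q]
    congr 1
    ext t
    simp only [BanachDynamicalSystem.iG_apply, BanachDynamicalSystem.iA_apply, D.map_mul]
    change _ = _ * (D.α s * D.α s⁻¹) _
    rw [← map_mul, mul_inv_cancel, map_one, inv_inv, mul_inv_cancel_left]
    rfl

section Transfer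

variable {R μ} {Y : Type*} [NormedAddCommGroup Y] [NormedSpace ℝ Y]

/-- The covariant representation `(S ∘ i_A^R, S ∘ i_G^R)` for a bounded unital representation `S`
of the left centralizer algebra for which `S ∘ i_G^R` is strongly continuous. -/
def covariantRepOfCentralizer
    (S : leftCentralizerAlgebra (R.CrossedProduct μ) →ₙₐ[ℝ] (Y →L[ℝ] Y)) (hb : IsBoundedRep S)
    (h1 : S 1 = 1) (hc : ∀ y, Continuous fun r => S (R.iG μ r) y) :
    ContinuousCovariantRep D Y where
  π := S.comp (R.iAHom μ)
  U :=
    { toFun := fun r => S (R.iG μ r)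
      map_one' := (congrArg S (map_one (R.iGHom μ))).trans h1
      map_mul' := fun r t => (congrArg S (map_mul (R.iGHom μ) r t)).trans (map_mul S _ _) }
  bounded := by
    obtain ⟨C, hC0, hC⟩ := norm_centralizer_apply_le hb
    obtain ⟨C', -, hC', -, -, hA, -⟩ := R.exists_norm_centralizer_le μ
    refine ⟨C * C', fun a => (hC _).trans ?_⟩
    rw [mul_assoc]
    exact mul_le_mul_of_nonneg_left (hA a) hC0
  continuous_apply := hc
  covariant s a := by
    change S (R.iA μ (D.α s a)) = S (R.iG μ s) * S (R.iA μ a) * S (R.iG μ s⁻¹)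
    rw [iA_α, map_mul, map_mul]

end Transfer

/-- The covariant representation `(i_A^R, i_G^R)` on the crossed product. -/
def regularRep : ContinuousCovariantRep D (R.CrossedProduct μ) :=
  covariantRepOfCentralizer (R := R) (μ := μ)
    (centralizerInclusion _) (isBoundedRep_centralizerInclusion _) rfl (R.continuous_iG_apply μ)

theorem regularRep_π (a : A) : (R.regularRep μ).π a = (R.iA μ a).1 := rfl

theorem regularRep_U (r : G) : (R.regularRep μ).U r = (R.iG μ r).1 := rfl

theorem isRContinuous_of_mem {P : BanachCovariantRep D} (hP : P ∈ R.reps) :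
    P.rep.IsRContinuous R μ :=
  ⟨1, fun f => by
    rw [one_mul]
    exact R.norm_integratedForm_le_sigma μ f hP⟩

end UniformlyBoundedClass

/-! ### Intertwining properties of `(π ⋊ U)^R` -/

namespace ContinuousCovariantRep

variable {D : BanachDynamicalSystem A G} {R : UniformlyBoundedClass.{u, v, w} D} {μ : Measure G}
  [μ.IsHaarMeasure] {X : Type*} [NormedAddCommGroup X] [NormedSpace ℝ X] [CompleteSpace X]
  (P : ContinuousCovariantRep D X) (hP : P.IsRContinuous R μ)

/-- `(π ⋊ U)^R` as a bounded linear map. -/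
def crossedL : R.CrossedProduct μ →L[ℝ] (X →L[ℝ] X) := R.induced μ (P.integratedForm μ) hP

theorem crossedL_apply (b : R.CrossedProduct μ) : P.crossedL hP b = P.crossed hP b := rfl

theorem isBoundedRep_crossed : IsBoundedRep (P.crossed hP) :=
  ⟨‖P.crossedL hP‖, (P.crossedL hP).le_opNorm⟩

theorem crossed_iA (a : A) (b : R.CrossedProduct μ) (x : X) :
    P.crossed hP ((R.iA μ a).1 b) x = P.π a (P.crossed hP b x) := by
  have : ((P.crossedL hP).flip x).comp (R.iA μ a).1 = (P.π a).comp ((P.crossedL hP).flip x) :=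
    UniformlyBoundedClass.clm_ext fun f => by
      change P.crossed hP ((R.iA μ a).1 (R.q μ f)) x = P.π a (P.crossed hP (R.q μ f) x)
      rw [R.iA_q, crossed_q, crossed_q, BanachDynamicalSystem.integratedForm_iA]
      rfl
  exact DFunLike.congr_fun this b

theorem crossed_iG (r : G) (b : R.CrossedProduct μ) (x : X) :
    P.crossed hP ((R.iG μ r).1 b) x = P.U r (P.crossed hP b x) := by
  have : ((P.crossedL hP).flip x).comp (R.iG μ r).1 = (P.U r).comp ((P.crossedL hP).flip x) :=
    UniformlyBoundedClass.clm_ext fun f => by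
      change P.crossed hP ((R.iG μ r).1 (R.q μ f)) x = P.U r (P.crossed hP (R.q μ f) x)
      rw [R.iG_q, crossed_q, crossed_q, BanachDynamicalSystem.integratedForm_iG]
      rfl
  exact DFunLike.congr_fun this b

/-- A continuous linear map on the crossed product that intertwines `(i_A^R, i_G^R)` with `(π, U)`
intertwines the integrated forms. -/
theorem map_integratedForm_regularRep {Φ : R.CrossedProduct μ →L[ℝ] X}
    (hA : ∀ a b, Φ ((R.iA μ a).1 b) = P.π a (Φ b)) (hG : ∀ r b, Φ ((R.iG μ r).1 b) = P.U r (Φ b))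
    (f : C_c(G, A)) (b : R.CrossedProduct μ) :
    Φ ((R.regularRep μ).integratedForm μ f b) = P.integratedForm μ f (Φ b) := by
  have := Φ.integral_comp_comm
    ((R.regularRep μ).integrable_integrand μ f (k := fun _ => b) continuous_const 1)
  rw [integratedForm_apply, integratedForm_apply, ← this]
  congr 1
  ext r
  rw [R.regularRep_π, R.regularRep_U, hA, hG]

end ContinuousCovariantRep

/-! ### Left multiplication as an integrated form, and the approximate left identity -/

namespace UniformlyBoundedClass

variable {D : BanachDynamicalSystem A G} (R : UniformlyBoundedClass.{u, v, w} D)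
  (μ : Measure G) [μ.IsHaarMeasure]

/-- The representations in the class `R` separate the points of the crossed product. -/
theorem eq_of_crossed_eq {a b : R.CrossedProduct μ}
    (h : ∀ (P : BanachCovariantRep D) (hP : P ∈ R.reps),
      P.rep.crossed (R.isRContinuous_of_mem μ hP) a =
        P.rep.crossed (R.isRContinuous_of_mem μ hP) b) : a = b := by
  rw [← sub_eq_zero, ← norm_eq_zero]
  refine le_antisymm (le_of_forall_pos_le_add fun ε hε => ?_) (norm_nonneg _)
  -- On a function the norm is literally a supremum over `R`. Each member kills `a - b` and is
  -- contractive on the crossed product, so on a function close to `a - b` it has norm at most the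
  -- distance.
  obtain ⟨f, hf⟩ := (R.denseRange_q μ).exists_dist_lt (a - b) (half_pos hε)
  rw [dist_eq_norm] at hf
  have hσ : R.sigma μ f ≤ ε / 2 := R.sigma_le μ fun P hP => by
    set Φ := P.rep.crossedL (R.isRContinuous_of_mem μ hP) with hΦ
    have hΦn : ‖Φ‖ ≤ 1 := opNorm_le_of_q zero_le_one fun g => by
      rw [hΦ, P.rep.crossedL_apply, P.rep.crossed_q, one_mul]
      exact R.norm_integratedForm_le_sigma μ g hP
    have e : P.rep.integratedForm μ f = -Φ (a - b - R.q μ f) := by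
      rw [map_sub, map_sub, hΦ, P.rep.crossedL_apply, P.rep.crossedL_apply, h P hP, sub_self,
        zero_sub, neg_neg, P.rep.crossedL_apply, P.rep.crossed_q]
    rw [e, norm_neg]
    exact (Φ.le_of_opNorm_le hΦn _).trans (by rw [one_mul]; exact hf.le)
  calc ‖a - b‖ = ‖(a - b - R.q μ f) + R.q μ f‖ := by rw [sub_add_cancel]
    _ ≤ ε / 2 + ε / 2 := (norm_add_le _ _).trans (add_le_add hf.le (by rwa [norm_q]))
    _ = 0 + ε := by ring

/-- The integrated form of `(i_A^R, i_G^R)` is the left regular representation. -/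
theorem integratedForm_regularRep (f : C_c(G, A)) (b : R.CrossedProduct μ) :
    (R.regularRep μ).integratedForm μ f b = R.q μ f * b := by
  refine R.eq_of_crossed_eq μ fun P hP => ContinuousLinearMap.ext fun x => ?_
  set hP' := R.isRContinuous_of_mem μ hP
  rw [NonUnitalAlgHom.mul_apply_apply, P.rep.crossed_q]
  -- The orbit map `b ↦ (π ⋊ U)^R(b) x` intertwines the pairs, so it sends the integral for `(i_A,
  -- i_G)` to `(π ⋊ U)(f)` applied to the image of `b`.
  exact P.rep.map_integratedForm_regularRep (Φ := (P.rep.crossedL hP').flip x)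
    (fun a b => P.rep.crossed_iA hP' a b x) (fun r b => P.rep.crossed_iG hP' r b x) f b

/-- The filter on the crossed product of the approximate left identity formed by the functions
`h ⊗ u i`, where `u` is an approximate left identity of `A` and `h` is concentrated at `1`. -/
def approxIdentityFilter {I : Type*} [Preorder I] (u : I → A) : Filter (R.CrossedProduct μ) :=
  (diracFilter μ ×ˢ atTop).map fun p : C_c(G, ℝ) × I => R.q μ (elementaryTensor p.1 (u p.2))

section ApproxIdentity

variable {I : Type*} [Preorder I] {u : I → A}

instance [IsDirectedOrder I] [Nonempty I] : (R.approxIdentityFilter μ u).NeBot := by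
  unfold approxIdentityFilter
  infer_instance

/-- Once `h` is supported in a fixed compact neighbourhood of `1`, the `L¹` bound for `σ` applies,
and the `L¹` norm of `h ⊗ u i` is exactly `‖u i‖`. -/
theorem eventually_norm_le_approxIdentityFilter (hu : IsBoundedApproxLeftIdentity u) :
    ∃ M : ℝ, ∀ᶠ e in R.approxIdentityFilter μ u, ‖e‖ ≤ M := by
  obtain ⟨M, hM⟩ := hu.bounded
  obtain ⟨N, hN, h1⟩ := exists_compact_mem_nhds (1 : G)
  obtain ⟨c, hc, hσ⟩ := R.exists_sigma_le_integral μ hN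
  refine ⟨c * M, ?_⟩
  refine eventually_map.2 (((eventually_mem_bumps μ h1).prod_inl atTop).mono fun p hp => ?_)
  obtain ⟨h0, hsupp, hint⟩ := hp
  rw [norm_q]
  refine (hσ _ ((tsupport_elementaryTensor_subset _ _).trans hsupp)).trans
    (mul_le_mul_of_nonneg_left ?_ hc)
  have : ∀ r, ‖elementaryTensor p.1 (u p.2) r‖ = p.1 r * ‖u p.2‖ := fun r => by
    rw [elementaryTensor_apply, norm_smul, Real.norm_of_nonneg (h0 r)]
  simp_rw [this]
  rw [integral_mul_const, hint, one_mul]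
  exact hM _

/-- Multiplication by `q(h ⊗ u i)` is an integrated form of `(i_A, i_G)`, so the general convergence
result for integrated forms applies once `i_A(u i) b → b`. -/
theorem tendsto_mul_approxIdentityFilter (hu : IsBoundedApproxLeftIdentity u)
    (b : R.CrossedProduct μ) :
    Tendsto (fun e => e * b) (R.approxIdentityFilter μ u) (𝓝 b) := by
  refine tendsto_map'_iff.2 ?_
  have := (R.regularRep μ).tendsto_integratedForm_approxIdentity μ hu.bounded (l := atTop)
    (R.tendsto_iA_apply μ hu.bounded hu.tendsto_mul b)
  exact this.congr fun p => R.integratedForm_regularRep μ _ b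

end ApproxIdentity

end UniformlyBoundedClass

end CrossedProduct

/-! ### Passing between covariant representations and representations of the crossed product -/

section Correspondence

set_option linter.unusedSectionVars false

variable {A : Type u} {G : Type v} [NonUnitalNormedRing A] [NormedSpace ℝ A]
  [IsScalarTower ℝ A A] [SMulCommClass ℝ A A] [CompleteSpace A]
  [Group G] [TopologicalSpace G] [IsTopologicalGroup G] [LocallyCompactSpace G] [T2Space G]
  [MeasurableSpace G] [BorelSpace G] {μ : Measure G} [μ.IsHaarMeasure]
  {X : Type*} [NormedAddCommGroup X] [NormedSpace ℝ X] [CompleteSpace X]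

section Unordered

variable {D : BanachDynamicalSystem A G} {R : UniformlyBoundedClass.{u, v, w} D}

namespace ContinuousCovariantRep

variable {P : ContinuousCovariantRep D X} (hP : P.IsRContinuous R μ)

theorem nondegenerate_crossed (hnd : P.Nondegenerate) : IsNondegenerateRep (P.crossed hP) :=
  (P.nondegenerate_integratedForm μ hnd).mono fun f x =>
    subset_closure (Submodule.subset_span ⟨R.q μ f, x, by rw [crossed_q]⟩)

variable {Tbar : leftCentralizerAlgebra (R.CrossedProduct μ) →ₙₐ[ℝ] (X →L[ℝ] X)}

theorem centralizerExtension_iA (hnd : P.Nondegenerate)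
    (h : IsCentralizerExtension (P.crossed hP) Tbar) (a : A) : Tbar (R.iA μ a) = P.π a :=
  (nondegenerate_crossed hP hnd).ext fun b x => by
    rw [h.apply_apply, crossed_iA]

theorem centralizerExtension_iG (hnd : P.Nondegenerate)
    (h : IsCentralizerExtension (P.crossed hP) Tbar) (r : G) : Tbar (R.iG μ r) = P.U r :=
  (nondegenerate_crossed hP hnd).ext fun b x => by
    rw [h.apply_apply, crossed_iG]

theorem ext_of_apply {P Q : ContinuousCovariantRep D X} (hπ : ∀ a, P.π a = Q.π a)
    (hU : ∀ r, P.U r = Q.U r) : P = Q := by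
  cases P
  cases Q
  congr
  · exact NonUnitalAlgHom.ext hπ
  · exact MonoidHom.ext hU

end ContinuousCovariantRep

namespace IsCentralizerExtension

variable {T : R.CrossedProduct μ →ₙₐ[ℝ] (X →L[ℝ] X)}
  {Tbar : leftCentralizerAlgebra (R.CrossedProduct μ) →ₙₐ[ℝ] (X →L[ℝ] X)}

theorem continuous_iG (h : IsCentralizerExtension T Tbar) (hT : IsNondegenerateRep T)
    (hb : IsBoundedRep T) (x : X) : Continuous fun r => Tbar (R.iG μ r) x := by
  rw [continuous_iff_continuousAt]
  intro r₀
  obtain ⟨N, hN, hr₀⟩ := exists_compact_mem_nhds r₀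
  obtain ⟨C, ν, -, -, hK, -, hG⟩ := R.exists_norm_centralizer_le μ
  obtain ⟨C', hC'0, hC'⟩ := norm_centralizer_apply_le h.bounded
  obtain ⟨M, hM⟩ := hK N hN
  have hbdd : ∀ᶠ r in 𝓝 r₀, ‖Tbar (R.iG μ r)‖ ≤ C' * M := by
    filter_upwards [hr₀] with r hr
    exact (hC' _).trans (mul_le_mul_of_nonneg_left ((hG r).trans (hM ⟨r, hr, rfl⟩)) hC'0)
  refine hT.tendsto ⟨C' * M, hbdd⟩ (fun b y => ?_) x
  simp_rw [h.apply_apply]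
  exact ((hb.continuous_apply y).comp (R.continuous_iG_apply μ b)).tendsto r₀

variable (h : IsCentralizerExtension T Tbar) (hT : IsNondegenerateRep T) (hb : IsBoundedRep T)

/-- The covariant representation `(Tbar ∘ i_A^R, Tbar ∘ i_G^R)`. -/
def covariantRep : ContinuousCovariantRep D X :=
  UniformlyBoundedClass.covariantRepOfCentralizer Tbar h.bounded (h.map_one hT)
    (h.continuous_iG hT hb)

/-- It suffices to test on vectors `T b y`. The map `c ↦ T c y` intertwines `(i_A, i_G)` with the
new pair, so the integrated form sends `T b y` to `T (q f * b) y = T (q f) (T b y)`. -/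
theorem integratedForm_covariantRep (f : C_c(G, A)) :
    (h.covariantRep hT hb).integratedForm μ f = T (R.q μ f) :=
  hT.ext fun b y => by
    let Φ : R.CrossedProduct μ →L[ℝ] (X →L[ℝ] X) := LinearMap.mkContinuousOfExistsBound
      { toFun := T, map_add' := map_add T, map_smul' := map_smul T } hb
    have := (h.covariantRep hT hb).map_integratedForm_regularRep (Φ := Φ.flip y)
      (fun a b => (h.apply_apply (R.iA μ a) b y).symm)
      (fun r b => (h.apply_apply (R.iG μ r) b y).symm) f b
    rw [R.integratedForm_regularRep] at this
    exact this.symm.trans (T.mul_apply_apply _ _ _)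

theorem isRContinuous_covariantRep : (h.covariantRep hT hb).IsRContinuous R μ := by
  obtain ⟨C, hC⟩ := id hb
  refine ⟨C, fun f => ?_⟩
  rw [integratedForm_covariantRep, ← R.norm_q μ]
  exact hC _

theorem crossed_covariantRep :
    (h.covariantRep hT hb).crossed (h.isRContinuous_covariantRep hT hb) = T := by
  let Φ : R.CrossedProduct μ →L[ℝ] (X →L[ℝ] X) := LinearMap.mkContinuousOfExistsBound
    { toFun := T, map_add' := map_add T, map_smul' := map_smul T } hb
  have : (h.covariantRep hT hb).crossedL (h.isRContinuous_covariantRep hT hb) = Φ :=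
    UniformlyBoundedClass.clm_ext fun f => by
      rw [ContinuousCovariantRep.crossedL_apply, ContinuousCovariantRep.crossed_q,
        integratedForm_covariantRep]
      rfl
  exact NonUnitalAlgHom.ext fun b => DFunLike.congr_fun this b

/-- The vector `T b x` is the limit of `T (i_A(u i) b) x`, and these equal `π(u i) (T b x)` for the
new `π`. -/
theorem nondegenerate_covariantRep {I : Type*} [Preorder I] [IsDirectedOrder I] [Nonempty I]
    {u : I → A} (hu : IsBoundedApproxLeftIdentity u) : (h.covariantRep hT hb).Nondegenerate :=
  hT.mono fun b x => by
    have := ((hb.continuous_apply x).tendsto b).comp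
      (R.tendsto_iA_apply μ hu.bounded hu.tendsto_mul b)
    refine mem_closure_of_tendsto this (Eventually.of_forall fun i => Submodule.subset_span ?_)
    exact ⟨u i, T b x, (h.apply_apply _ _ _).symm⟩

end IsCentralizerExtension

end Unordered

/-! ### Positivity -/

namespace PreorderedBanachDynamicalSystem

variable {D : PreorderedBanachDynamicalSystem A G}
  {R : UniformlyBoundedClass.{u, v, w} D.toBanachDynamicalSystem}

theorem q_mem_crossedCone {f : C_c(G, A)} (hf : f ∈ D.ccCone) : R.q μ f ∈ D.crossedCone R μ :=
  subset_closure ⟨f, hf, rfl⟩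

theorem crossedCone_induction {p : R.CrossedProduct μ → Prop} (hp : IsClosed {b | p b})
    (h : ∀ f ∈ D.ccCone, p (R.q μ f)) {b : R.CrossedProduct μ} (hb : b ∈ D.crossedCone R μ) :
    p b := by
  have hsub : (D.ccCone.map (R.q μ) : Set (R.CrossedProduct μ)) ⊆ {b | p b} := by
    rintro _ ⟨f, hf, rfl⟩
    exact h f hf
  exact closure_minimal hsub hp (PointedCone.mem_closure.1 hb)

theorem isClosed_crossedCone : IsClosed (D.crossedCone R μ : Set (R.CrossedProduct μ)) :=
  isClosed_closure

theorem iA_mem_cone {a : A} (ha : a ∈ D.cone) :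
    R.iA μ a ∈ leftCentralizerCone (D.crossedCone R μ) := fun b hb =>
  crossedCone_induction (p := fun b => (R.iA μ a).1 b ∈ D.crossedCone R μ)
    (isClosed_crossedCone.preimage (R.iA μ a).1.continuous) (fun f hf => by
      rw [R.iA_q]
      exact q_mem_crossedCone fun s => D.mul_mem_cone a ha _ (hf s)) hb

theorem iG_mem_cone (r : G) : R.iG μ r ∈ leftCentralizerCone (D.crossedCone R μ) := fun b hb =>
  crossedCone_induction (p := fun b => (R.iG μ r).1 b ∈ D.crossedCone R μ)
    (isClosed_crossedCone.preimage (R.iG μ r).1.continuous) (fun f hf => by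
      rw [R.iG_q]
      exact q_mem_crossedCone fun s => D.α_mem_cone r _ (hf _)) hb

theorem isClosed_operatorCone {K : PointedCone ℝ X} (hK : IsClosed (K : Set X)) :
    IsClosed (operatorCone K : Set (X →L[ℝ] X)) := by
  have : (operatorCone K : Set (X →L[ℝ] X)) = ⋂ x ∈ K, {T | T x ∈ (K : Set X)} := by
    ext T
    simp only [Set.mem_iInter]
    rfl
  rw [this]
  exact isClosed_biInter fun x _ =>
    hK.preimage (ContinuousLinearMap.apply ℝ X x).continuous

theorem isPositiveRep_crossed {P : ContinuousCovariantRep D.toBanachDynamicalSystem X}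
    (hP : P.IsRContinuous R μ) {K : PointedCone ℝ X} (hK : IsClosed (K : Set X))
    (hpos : P.Positive K) : IsPositiveRep (D.crossedCone R μ) K (P.crossed hP) := fun _ hb =>
  crossedCone_induction (p := fun b => P.crossed hP b ∈ operatorCone K)
    ((isClosed_operatorCone hK).preimage (P.crossedL hP).continuous) (fun f hf => by
      rw [P.crossed_q]
      exact ContinuousCovariantRep.integratedForm_positive μ hK hpos hf) hb

/-- Here the non-negativity of the bumps and the positivity of the `u i` are both used; this is what
makes the extension to centralizers positive. -/
theorem eventually_mem_crossedCone {I : Type*} [Preorder I] {u : I → A}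
    (hu : ∀ i, u i ∈ D.cone) : ∀ᶠ e in R.approxIdentityFilter μ u, e ∈ D.crossedCone R μ := by
  refine eventually_map.2
    (((eventually_mem_bumps μ univ_mem).prod_inl atTop).mono fun p hp => ?_)
  exact q_mem_crossedCone fun s => D.cone.smul_mem (hp.1 s) (hu _)

end PreorderedBanachDynamicalSystem

end Correspondence

end

/-! ### The correspondence theorem -/

theorem theorem3p9
    {A : Type u} {G : Type v} [NonUnitalNormedRing A] [NormedSpace ℝ A]
    [IsScalarTower ℝ A A] [SMulCommClass ℝ A A] [CompleteSpace A]
    [Group G] [TopologicalSpace G] [IsTopologicalGroup G] [LocallyCompactSpace G] [T2Space G]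
    [MeasurableSpace G] [BorelSpace G] (μ : Measure G) [μ.IsHaarMeasure]
    (D : PreorderedBanachDynamicalSystem A G)
    {I : Type i} [Preorder I] [IsDirectedOrder I] [Nonempty I] (u : I → A)
    (hu : IsBoundedApproxLeftIdentity u) (hu_pos : ∀ j, u j ∈ D.cone)
    (R : UniformlyBoundedClass.{u, v, w} D.toBanachDynamicalSystem)
    (hR : ∀ P ∈ R.reps, P.rep.Nondegenerate)
    {X : Type x} [NormedAddCommGroup X] [NormedSpace ℝ X] [CompleteSpace X]
    (K : PointedCone ℝ X) (hK : IsClosed (K : Set X)) :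
    -- `(π, U) ↦ (π ⋊ U)^R` is a bijection between the two classes of representations on `(X, K)`
    Set.BijOn
      (fun P : {P : ContinuousCovariantRep D.toBanachDynamicalSystem X //
        P.IsRContinuous R μ} => P.1.crossed P.2)
      {P | P.1.Nondegenerate ∧ P.1.Positive K}
      {T | IsNondegenerateRep T ∧ IsBoundedRep T ∧ IsPositiveRep (D.crossedCone R μ) K T} ∧
    -- for `T = (π ⋊ U)^R`, the canonical extension `Tbar` exists, is positive, and recovers `(π, U)`
    (∀ (P : ContinuousCovariantRep D.toBanachDynamicalSystem X) (hP : P.IsRContinuous R μ),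
      P.Nondegenerate → P.Positive K →
      ∃ Tbar : leftCentralizerAlgebra (R.CrossedProduct μ) →ₙₐ[ℝ] (X →L[ℝ] X),
        IsCentralizerExtension (P.crossed hP) Tbar ∧
        IsPositiveRep (leftCentralizerCone (D.crossedCone R μ)) K Tbar ∧
        (∀ a, Tbar (R.iA μ a) = P.π a) ∧ ∀ s, Tbar (R.iG μ s) = P.U s) ∧
    -- for every `T`, the pair `(Tbar ∘ i_A^R, Tbar ∘ i_G^R)` lies in the first class and
    -- is mapped to `T`
    (∀ T : R.CrossedProduct μ →ₙₐ[ℝ] (X →L[ℝ] X),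
      IsNondegenerateRep T → IsBoundedRep T → IsPositiveRep (D.crossedCone R μ) K T →
      ∃ Tbar : leftCentralizerAlgebra (R.CrossedProduct μ) →ₙₐ[ℝ] (X →L[ℝ] X),
        IsCentralizerExtension T Tbar ∧
        IsPositiveRep (leftCentralizerCone (D.crossedCone R μ)) K Tbar ∧
        ∃ (P : ContinuousCovariantRep D.toBanachDynamicalSystem X) (hP : P.IsRContinuous R μ),
          P.Nondegenerate ∧ P.Positive K ∧
          (∀ a, P.π a = Tbar (R.iA μ a)) ∧ (∀ s, P.U s = Tbar (R.iG μ s)) ∧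
          P.crossed hP = T) := by
  obtain ⟨hl, hl'⟩ := And.intro (R.eventually_norm_le_approxIdentityFilter μ hu)
    (R.tendsto_mul_approxIdentityFilter μ hu)
  have hext : ∀ T : R.CrossedProduct μ →ₙₐ[ℝ] (X →L[ℝ] X), IsNondegenerateRep T →
      IsBoundedRep T → IsPositiveRep (D.crossedCone R μ) K T →
      ∃ Tbar : leftCentralizerAlgebra (R.CrossedProduct μ) →ₙₐ[ℝ] (X →L[ℝ] X),
        IsCentralizerExtension T Tbar ∧
        IsPositiveRep (leftCentralizerCone (D.crossedCone R μ)) K Tbar := by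
    intro T hT hb hpos
    obtain ⟨Tbar, h⟩ := exists_isCentralizerExtension hT hb hl hl'
    exact ⟨Tbar, h, h.positive hK hpos hl hl'
      (PreorderedBanachDynamicalSystem.eventually_mem_crossedCone hu_pos)⟩
  have hto : ∀ (P : ContinuousCovariantRep D.toBanachDynamicalSystem X)
      (hP : P.IsRContinuous R μ), P.Nondegenerate → P.Positive K →
      ∃ Tbar : leftCentralizerAlgebra (R.CrossedProduct μ) →ₙₐ[ℝ] (X →L[ℝ] X),
        IsCentralizerExtension (P.crossed hP) Tbar ∧
        IsPositiveRep (leftCentralizerCone (D.crossedCone R μ)) K Tbar ∧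
        (∀ a, Tbar (R.iA μ a) = P.π a) ∧ ∀ s, Tbar (R.iG μ s) = P.U s := by
    intro P hP hnd hpos
    obtain ⟨Tbar, h, hTpos⟩ := hext _ (P.nondegenerate_crossed hP hnd)
      (P.isBoundedRep_crossed hP) (D.isPositiveRep_crossed hP hK hpos)
    exact ⟨Tbar, h, hTpos, P.centralizerExtension_iA hP hnd h,
      P.centralizerExtension_iG hP hnd h⟩
  have hfrom : ∀ T : R.CrossedProduct μ →ₙₐ[ℝ] (X →L[ℝ] X),
      IsNondegenerateRep T → IsBoundedRep T → IsPositiveRep (D.crossedCone R μ) K T →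
      ∃ Tbar : leftCentralizerAlgebra (R.CrossedProduct μ) →ₙₐ[ℝ] (X →L[ℝ] X),
        IsCentralizerExtension T Tbar ∧
        IsPositiveRep (leftCentralizerCone (D.crossedCone R μ)) K Tbar ∧
        ∃ (P : ContinuousCovariantRep D.toBanachDynamicalSystem X) (hP : P.IsRContinuous R μ),
          P.Nondegenerate ∧ P.Positive K ∧
          (∀ a, P.π a = Tbar (R.iA μ a)) ∧ (∀ s, P.U s = Tbar (R.iG μ s)) ∧
          P.crossed hP = T := by
    intro T hT hb hpos
    obtain ⟨Tbar, h, hTpos⟩ := hext T hT hb hpos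
    exact ⟨Tbar, h, hTpos, h.covariantRep hT hb, h.isRContinuous_covariantRep hT hb,
      h.nondegenerate_covariantRep hT hb hu,
      ⟨fun a ha => hTpos _ (PreorderedBanachDynamicalSystem.iA_mem_cone ha),
        fun s => hTpos _ (PreorderedBanachDynamicalSystem.iG_mem_cone s)⟩,
      fun _ => rfl, fun _ => rfl, h.crossed_covariantRep hT hb⟩
  refine ⟨⟨fun P hP => ⟨P.1.nondegenerate_crossed P.2 hP.1, P.1.isBoundedRep_crossed P.2,
    D.isPositiveRep_crossed P.2 hK hP.2⟩, ?_, ?_⟩, hto, hfrom⟩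
  · rintro ⟨P, hP⟩ ⟨hPn, hPpos⟩ ⟨Q, hQ⟩ ⟨hQn, -⟩ hPQ
    obtain ⟨Tbar, h, -, hA, hG⟩ := hto P hP hPn hPpos
    -- Both pairs induce the same `T`, so one extension `Tbar` serves both, and each pair is
    -- recovered from it by composing with `i_A` and `i_G`.
    have h' : IsCentralizerExtension (Q.crossed hQ) Tbar := by
      have e : P.crossed hP = Q.crossed hQ := hPQ
      rwa [← e]
    exact Subtype.ext (ContinuousCovariantRep.ext_of_apply
      (fun a => (hA a).symm.trans (Q.centralizerExtension_iA hQ hQn h' a))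
      fun r => (hG r).symm.trans (Q.centralizerExtension_iG hQ hQn h' r))
  · rintro T ⟨hT, hb, hpos⟩
    obtain ⟨-, -, -, P, hP, hPn, hPpos, -, -, hPT⟩ := hfrom T hT hb hpos
    exact ⟨⟨P, hP⟩, ⟨hPn, hPpos⟩, hPT⟩
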